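/- **Setting.** Let $X\subseteq\mathbb R^n$ be closed and convex, let $f:X\to\mathbb R$ be convex, and let $f'$ be a first-order oracle: for each $x\in X$, $f'(x)$ is a subgradient, i.e. $f(z)\ge f(x)+\langle f'(x),z-x\rangle$ for all $z\in X$. Write $\ell_f(x;z)=f(z)+\langle f'(z),x-z\rangle$, $f^*=\min_X f$, $X^*=\operatorname{argmin}_X f$ (assumed nonempty); $\|\cdot\|$ is the Euclidean norm. * $f$ satisfies *$\mu^*$-QG* if $\mu^*=\sup\{\mu: f(x)-f^*\ge\frac{\mu}{2}\operatorname{dist}^2(x,X^*)\ \forall x\in X\}$; here $0<\mu^*<\infty$. * $f$ is *$(k,L)$-PWS* ($L>0$) if $X=X_1\cup\dots\cup X_k$ for some sets $X_i$ with $f(x)-\ell_f(x;z)\le\frac L2\|x-z\|^2$ for all $x,z\in X_i$ and all $i$. Let $\alpha_t=4/(t+3)$ and $\omega_t=(t+2)(t+3)/2$. **One-step** (reference point $\bar y$, level $\tilde l$, number of cuts $m$; input $\hat x^{t-1}$, $x^{t,0}$). For $i=1,\dots,m$: put $\underline x^{t,i}=(1-\alpha_t)\hat x^{t-1}+\alpha_t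 x^{t,i-1}$, evaluate $f'(\underline x^{t,i})$, let $x^{t,i}$ minimize $\|x-\bar y\|^2$ over $\{x\in X:\ \ell_f(x;\underline x^{t,j})\le\tilde l\ (1\le j\le i),\ \langle x-x^{t,0},x^{t,0}-\bar y\rangle\ge0\}$ (if this set is empty, stop and report *infeasible*), and put $\bar x^{t,i}=(1-\alpha_t)\hat x^{t-1}+\alpha_t x^{t,i}$. Then $\hat x^t$ is a point of $\{\hat x^{t-1},\bar x^{t,1},\dots,\bar x^{t,m}\}$ with the least value of $f$; $x^t=x^{t+1,0}=x^{t,m}$; $(r_t,l_t)$ minimizes over $0\le l<r\le m$ $$L_t(r,l)=\frac{f(\hat x^t)-\tilde l-(1-\frac34\alpha_t)(f(\hat x^{t-1})-\tilde l)}{\frac{\alpha_t^2}{2}\|x^{t,r}-x^{t,l}\|^2},\qquad L_t=L_t(r_t,l_t).$$ Ties are broken arbitrarily. With $\mathcal E(t)=\{f(\hat x^t)-\tilde l>(1-\frac{\alpha_t}2)(f(\hat x^{t-1})-\tilde l)\}$ and $d_t=\|x^{t,r_t}-x^{t,l_t}\|$, set $$\bar L(t)=\frac{\sum_{\tau\le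 t}\omega_\tau\alpha_\tau^2L_\tau\mathbf 1_{\mathcal E(\tau)}d_\tau^2/2}{\sum_{\tau\le t}\mathbf 1_{\mathcal E(\tau)}d_\tau^2}.$$ Throughout, a quotient with denominator $0$ and the square root of a negative number are read as $0$. **AWG**$(\bar y,\Delta,\iota,\beta)$. Level $\tilde l=f(\bar y)-(1+\beta)\Delta$, $\hat x^0=x^{1,0}=\bar y$. For $t=1,2,\dots$ perform One-step; if it is infeasible or $\|x^t-\bar y\|>\iota$, return *true*; otherwise, if $\bar L(t)\|x^t-\bar y\|^2<\omega_t\beta\Delta-3(1+\beta)\Delta$ or $t\ge\sqrt{(2\iota^2\bar L(t)+6(1+\beta)\Delta)/(\beta\Delta)}$, return *false*. **AGR**$(\underline f,\Delta,\bar y,\mu,\theta)$. Level $\tilde l=f(\bar y)-\theta\Delta$, $\hat x^0=x^{1,0}=\bar y$. For $t=1,2,\dots$ perform One-step; if it is infeasible or $\|x^t-\bar y\|^2\ge2\theta\Delta/\mu$, return *lower*; else if $f(\hat x^t)-\underline f\le\theta\Delta$, return *upper* and $\hat x^t$; else if $t\ge\left\lceil\sqrt{\frac{6\theta}{2\theta-1}+\frac{4\bar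 L(t)\theta}{\mu(2\theta-1)}}\right\rceil$, return *false*. **rApex for unknown $\mu^*$** (input $\bar y^0\in X$, $\hat\mu_1>0$, $m$, $\theta\in(\frac12,1)$, $\beta>0$). Start with $\tilde\Delta_1=2\|f'(\bar y^0)\|^2/\hat\mu_1$, $\underline f=f(\bar y^0)-\tilde\Delta_1$, $\Delta_0=+\infty$, $\mu_0=1$. For $s=1,2,\dots$ (with $\hat\mu_s$ inherited from the end of stage $s-1$ if $s>1$): 1. Run AWG$(\bar y^{s-1},\tilde\Delta_s,\sqrt{2(1+\beta)\tilde\Delta_s/\hat\mu_s},\beta)$. If it returns false: $\hat\mu_s\leftarrow\hat\mu_s/4$, then $\tilde\Delta_s\leftarrow\min\{\frac{9\mu_{s-1}}{4\hat\mu_s}\Delta_{s-1},\frac2{\hat\mu_s}\|f'(\bar y^{s-1})\|^2\}$, $\underline f\leftarrow f(\bar y^{s-1})-\tilde\Delta_s$; repeat 1. 2. Set $\Delta_s=(1+\beta)\tilde\Delta_s$, $\mu_s=\hat\mu_s$. 3. Run AGR$(\underline f,\tilde\Delta_s,\bar y^{s-1},\hat\mu_s,\theta)$. If it returns false: $\hat\mu_s\leftarrow\hat\mu_s/4$,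 then $\tilde\Delta_s\leftarrow\min\{4\Delta_s,\frac2{\hat\mu_s}\|f'(\bar y^{s-1})\|^2,\frac{9\mu_{s-1}}{4\hat\mu_s}\Delta_{s-1}\}$, $\underline f\leftarrow f(\bar y^{s-1})-\tilde\Delta_s$; go to 1. If it returns lower: $\tilde\Delta_s\leftarrow\theta\tilde\Delta_s$, $\underline f\leftarrow f(\bar y^{s-1})-\tilde\Delta_s$, $\Delta_s\leftarrow\tilde\Delta_s$, $\mu_s\leftarrow\hat\mu_s$; repeat 3. If it returns upper: $\bar y^s=\hat x^t$, $\tilde\Delta_{s+1}=f(\bar y^s)-\underline f$; go to stage $s+1$. Gradient oracle calls are all evaluations of $f'$: one per inner step of One-step, one at the start, and one each time $\hat\mu_s$ is divided by $4$. **Theorem.** For all $\theta\in(\frac12,1)$ and $\beta>0$ there is a constant $C>0$ depending only on $\theta,\beta$ such that the following holds. Suppose $f$ is convex, satisfies $\mu^*$-QG with $\mu^*>0$ and is $(k,L)$-PWS, and $m\ge k$, $\hat\mu_1\ge\mu^*$, $\bar y^0\in X$. Then rApex never gets stuck (all its steps are well defined), and for every run and every $\varepsilon>0$ it reaches a point $\bar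 y=\bar y^{s-1}$ with $f(\bar y)-f^*\le\varepsilon$ after at most $$C\,m\,\max\Big\{1,\sqrt{\tfrac{L}{\mu^*}}\Big\}\left(\log_4\frac{4\hat\mu_1}{\mu^*}+\max\Big\{0,\log\frac{\|f'(\bar y^0)\|^2}{\mu^*\varepsilon}\Big\}\right)$$ gradient oracle calls (with $\log 0$ read as $-\infty$). -/

import Mathlib

namespace RApex

noncomputable section

/-- Euclidean space `ℝⁿ` with the `l₂`-norm. -/
abbrev E (n : ℕ) : Type := EuclideanSpace ℝ (Fin n)

/-! ### The problem class -/

section ProblemClass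

variable {n : ℕ} (X : Set (E n)) (f : E n → ℝ) (g : E n → E n)

/-- The optimal value `f* = min_{x ∈ X} f x` (only used when a minimizer exists). -/
def optVal : ℝ := sInf (f '' X)

/-- The minimizer set `X* = argmin_{x ∈ X} f x`. -/
def minimizers : Set (E n) := {x | x ∈ X ∧ ∀ z ∈ X, f x ≤ f z}

/-- `g` is a first-order oracle for `f` on `X`: `g x` is a subgradient of `f : X → ℝ` at `x`. -/
def IsSubgradientOracle : Prop :=
  ∀ x ∈ X, ∀ z ∈ X, f x + inner ℝ (g x) (z - x) ≤ f z

/-- The linearization `ℓ_f(x; z) = f z + ⟨f' z, x - z⟩`. -/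
def linearization (x z : E n) : ℝ := f z + inner ℝ (g z) (x - z)

/-- `(k, L)`-piecewise smoothness of `f : X → ℝ` with first-order oracle `g`.  The pieces are
arbitrary sets (not necessarily convex, connected, closed or disjoint). -/
def IsPiecewiseSmooth (k : ℕ) (L : ℝ) : Prop :=
  0 < L ∧ ∃ P : Fin k → Set (E n), (⋃ i, P i) = X ∧
    ∀ i, ∀ x ∈ P i, ∀ z ∈ P i, f x - linearization f g x z ≤ L * ‖x - z‖ ^ 2 / 2

/-- `f : X → ℝ` has a nonempty minimizer set and `μ` is its modulus of quadratic growth, i.e. the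
supremum of all `ν` with `f x - f* ≥ ν dist(x, X*)² / 2` on `X`. -/
def HasQuadraticGrowthModulus (μ : ℝ) : Prop :=
  (minimizers X f).Nonempty ∧
    IsLUB {ν : ℝ | ∀ x ∈ X, ν * Metric.infDist x (minimizers X f) ^ 2 / 2 ≤ f x - optVal X f} μ

end ProblemClass

/-! ### One outer iteration of the accelerated prox-level method -/

/-- The step weights `α_t = 4 / (t + 3)`. -/
def alpha (t : ℕ) : ℝ := 4 / ((t : ℝ) + 3)

/-- The averaging weights `ω_t = (t + 2)(t + 3) / 2`. -/
def omega (t : ℕ) : ℝ := ((t : ℝ) + 2) * ((t : ℝ) + 3) / 2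

/-- The averaged point `(1 - a) x̂ + a x`. -/
def mix {n : ℕ} (a : ℝ) (xhat x : E n) : E n := (1 - a) • xhat + a • x

/-- What one outer iteration reports. -/
inductive OneStepResult (n : ℕ) : Type
  /-- All `m` subproblems were feasible: the selected point `x̂^t`, the last projection
  `x^{t,m}`, the estimate `L_t = L_t(r_t, l_t)` and the distance `‖x^{t,r_t} - x^{t,l_t}‖`. -/
  | feasible (xhat x : E n) (Lt dist : ℝ) : OneStepResult n
  /-- The subproblem of some inner step was infeasible (the flag is raised).  Both callers then
  return at once and read none of the other outputs; only the number of gradients evaluated so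
  far is recorded. -/
  | infeasible (calls : ℕ) : OneStepResult n

section OneStep

variable {n : ℕ} (X : Set (E n)) (f : E n → ℝ) (g : E n → E n)
  (ybar : E n) (lvl : ℝ) (a : ℝ) (xhat : E n)

/-- The feasible set `X(t, i)` of the `i`-th subproblem, where `x j` stands for `x^{t,j}`: the
points of `X` satisfying the `i` cuts `ℓ_f(·; (1 - a) x̂ + a x^{t,j-1}) ≤ lvl`, `1 ≤ j ≤ i`, and
`⟨z - x^{t,0}, x^{t,0} - ȳ⟩ ≥ 0`. -/
def levelSet (x : ℕ → E n) (i : ℕ) : Set (E n) :=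
  {z | z ∈ X ∧ (∀ j < i, linearization f g z (mix a xhat (x j)) ≤ lvl) ∧
    0 ≤ (inner ℝ (z - x 0) (x 0 - ybar) : ℝ)}

/-- `x^{t,1}, …, x^{t,j}` solve the first `j` subproblems: `x^{t,i}` minimizes `‖· - ȳ‖²` over
`X(t, i)`. -/
def SolvesSubproblems (x : ℕ → E n) (j : ℕ) : Prop :=
  ∀ i, 1 ≤ i → i ≤ j →
    x i ∈ levelSet X f g ybar lvl a xhat x i ∧
      ∀ z ∈ levelSet X f g ybar lvl a xhat x i, ‖x i - ybar‖ ^ 2 ≤ ‖z - ybar‖ ^ 2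

/-- `xnew` has the smallest value of `f` among `x̂^{t-1}` and `x̄^{t,1}, …, x̄^{t,m}`, where
`x̄^{t,j} = (1 - a) x̂^{t-1} + a x^{t,j}`. -/
def IsBestPoint (x : ℕ → E n) (m : ℕ) (xnew : E n) : Prop :=
  (xnew = xhat ∨ ∃ j, 1 ≤ j ∧ j ≤ m ∧ xnew = mix a xhat (x j)) ∧
    f xnew ≤ f xhat ∧ ∀ j, 1 ≤ j → j ≤ m → f xnew ≤ f (mix a xhat (x j))

/-- The local smoothness estimate `L_t(r, l)`. -/
def smoothEst (x : ℕ → E n) (xnew : E n) (r l : ℕ) : ℝ :=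
  ((f xnew - lvl) - (1 - 3 / 4 * a) * (f xhat - lvl)) / (a ^ 2 / 2 * ‖x r - x l‖ ^ 2)

/-- `OneStep X f g ybar lvl a xhat m x0 res`: the outer iteration with reference point `ȳ`, level
`lvl`, weight `a = α_t`, `m` inner steps, started from `x̂^{t-1} = xhat` and `x^{t,0} = x0`, may
report `res`.  Ties (in the choice of `x̂^t` and of the pair `(r_t, l_t)`) may be broken in any
way.  Inner step `i` evaluates one gradient, at `(1 - a) x̂^{t-1} + a x^{t,i-1}`. -/
inductive OneStep (m : ℕ) (x0 : E n) : OneStepResult n → Prop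
  | feasible (x : ℕ → E n) (xnew : E n) (r l : ℕ)
      (h_start : x 0 = x0)
      (h_solves : SolvesSubproblems X f g ybar lvl a xhat x m)
      (h_best : IsBestPoint f a xhat x m xnew)
      (h_lr : l < r) (h_rm : r ≤ m)
      (h_argmin : ∀ r' l', l' < r' → r' ≤ m →
        smoothEst f lvl a xhat x xnew r l ≤ smoothEst f lvl a xhat x xnew r' l') :
      OneStep m x0 (.feasible xnew (x m) (smoothEst f lvl a xhat x xnew r l) ‖x r - x l‖)
  | infeasible (x : ℕ → E n) (i : ℕ)
      (h_start : x 0 = x0) (h_pos : 1 ≤ i) (h_im : i ≤ m)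
      (h_solves : SolvesSubproblems X f g ybar lvl a xhat x (i - 1))
      (h_empty : levelSet X f g ybar lvl a xhat x i = ∅) :
      OneStep m x0 (.infeasible i)

end OneStep

/-! ### The restarted method for an unknown quadratic growth modulus -/

/-- The subroutine that is currently running: certificate generation or gap reduction. -/
inductive Phase : Type
  | awg
  | agr

/-- The variables of a subroutine after `t` outer iterations. -/
structure Sub (n : ℕ) : Type where
  /-- the number of completed outer iterations -/
  t : ℕ
  /-- `x̂^t` -/
  xhat : E n
  /-- `x^t = x^{t,m}`, which is also `x^{t+1,0}` -/
  x : E n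
  /-- `∑ ω_τ α_τ² L_τ 1_{𝓔(τ)} ‖x^{τ,r_τ} - x^{τ,l_τ}‖² / 2` over `1 ≤ τ ≤ t` -/
  num : ℝ
  /-- `∑ 1_{𝓔(τ)} ‖x^{τ,r_τ} - x^{τ,l_τ}‖²` over `1 ≤ τ ≤ t` -/
  den : ℝ

/-- The variables of a subroutine called at the reference point `y`. -/
def Sub.start {n : ℕ} (y : E n) : Sub n := ⟨0, y, y, 0, 0⟩

/-- The averaged smoothness estimate `L̄(t)` (`0` if no event `𝓔(τ)` has occurred). -/
def Sub.Lbar {n : ℕ} (c : Sub n) : ℝ := c.num / c.den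

open Classical in
/-- The variables after one more feasible outer iteration at level `lvl`.  The event is
`𝓔(t) : f(x̂^t) - lvl > (1 - α_t / 2) (f(x̂^{t-1}) - lvl)`. -/
def Sub.advance {n : ℕ} (f : E n → ℝ) (lvl : ℝ) (c : Sub n) (xnew x : E n) (Lt d : ℝ) : Sub n where
  t := c.t + 1
  xhat := xnew
  x := x
  num := c.num + if (1 - alpha (c.t + 1) / 2) * (f c.xhat - lvl) < f xnew - lvl
    then omega (c.t + 1) * alpha (c.t + 1) ^ 2 * Lt * d ^ 2 / 2 else 0
  den := c.den + if (1 - alpha (c.t + 1) / 2) * (f c.xhat - lvl) < f xnew - lvl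
    then d ^ 2 else 0

/-- The variables of the main algorithm during its outer iteration `s`. -/
structure State (n : ℕ) : Type where
  phase : Phase
  /-- the variables of the running subroutine -/
  sub : Sub n
  /-- the current solution `ȳ^{s-1}`; the upper bound on `f*` is always `f ȳ^{s-1}` -/
  y : E n
  /-- the lower estimate of `f*` -/
  flow : ℝ
  /-- the estimate `μ̂_s` -/
  muhat : ℝ
  /-- the gap estimate `Δ̃_s` -/
  gap : ℝ
  /-- the pair `(μ_s, Δ_s)` of the latest certificate at `ȳ^{s-1}`; it is assigned before it is
  read -/
  cert : ℝ × ℝ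
  /-- the pair `(μ_{s-1}, Δ_{s-1})`; `none` in the first outer iteration, where `Δ_0 = +∞` -/
  prev : Option (ℝ × ℝ)
  /-- the number of gradient evaluations so far -/
  calls : ℕ

/-- `min {9 μ_{s-1} Δ_{s-1} / (4 μ̂), b}`, which is `b` in the first outer iteration. -/
def transferMin (prev : Option (ℝ × ℝ)) (muhat b : ℝ) : ℝ :=
  match prev with
  | none => b
  | some (muprev, gapprev) => min (9 * muprev / (4 * muhat) * gapprev) b

section Main

variable {n : ℕ} (X : Set (E n)) (f : E n → ℝ) (g : E n → E n) (m : ℕ) (θ β : ℝ)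

/-- The initial state; the gradient at `ȳ⁰` has been evaluated. -/
def init (y0 : E n) (muhat1 : ℝ) : State n where
  phase := .awg
  sub := Sub.start y0
  y := y0
  flow := f y0 - 2 * ‖g y0‖ ^ 2 / muhat1
  muhat := muhat1
  gap := 2 * ‖g y0‖ ^ 2 / muhat1
  cert := (0, 0)
  prev := none
  calls := 1

/-- Replace `μ̂_s` by `newMu` and `Δ̃_s` by `newGap`, reset the lower estimate, and go back to
certificate generation.  The gradient evaluated at `ȳ^{s-1}` is counted. -/
def State.requarter (S : State n) (newMu newGap : ℝ) : State n :=
  { S with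
    phase := .awg
    sub := Sub.start S.y
    flow := f S.y - newGap
    muhat := newMu
    gap := newGap
    calls := S.calls + 1 }

/-- Certificate generation has failed. -/
def State.awgFail (S : State n) : State n :=
  S.requarter f (S.muhat / 4)
    (transferMin S.prev (S.muhat / 4) (2 / (S.muhat / 4) * ‖g S.y‖ ^ 2))

/-- Certificate generation has succeeded: record `μ_s` and `Δ_s` and call gap reduction. -/
def State.awgSucceed (S : State n) : State n :=
  { S with
    phase := .agr
    sub := Sub.start S.y
    cert := (S.muhat, (1 + β) * S.gap) }

/-- Gap reduction has failed. -/
def State.agrFail (S : State n) : State n :=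
  S.requarter f (S.muhat / 4)
    (min (4 * S.cert.2)
      (transferMin S.prev (S.muhat / 4) (2 / (S.muhat / 4) * ‖g S.y‖ ^ 2)))

/-- Gap reduction has improved the lower bound: shrink the gap and call gap reduction again. -/
def State.agrLower (S : State n) : State n :=
  { S with
    sub := Sub.start S.y
    flow := f S.y - θ * S.gap
    gap := θ * S.gap
    cert := (S.muhat, θ * S.gap) }

/-- Gap reduction has improved the upper bound: the point found becomes `ȳ^s`, and outer iteration
`s + 1` starts. -/
def State.agrUpper (S : State n) (xnew : E n) : State n :=
  { S with
    phase := .awg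
    sub := Sub.start xnew
    y := xnew
    gap := f xnew - S.flow
    prev := some S.cert }

/-- The level used by the running subroutine. -/
def State.level (S : State n) : ℝ :=
  match S.phase with
  | .awg => f S.y - (1 + β) * S.gap
  | .agr => f S.y - θ * S.gap

/-- The radius `ι_max = √(2 (1 + β) Δ̃_s / μ̂_s)` handed to certificate generation. -/
def State.radius (S : State n) : ℝ := Real.sqrt (2 * (1 + β) * S.gap / S.muhat)

open Classical in
/-- The tests of certificate generation, made after a feasible outer iteration that has led to the
subroutine variables `c`. -/
def State.awgTest (S : State n) (c : Sub n) : State n :=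
  if S.radius β < ‖c.x - S.y‖ then
    S.awgSucceed β
  else if c.Lbar * ‖c.x - S.y‖ ^ 2 < omega c.t * β * S.gap - 3 * (1 + β) * S.gap ∨
      Real.sqrt ((2 * S.radius β ^ 2 * c.Lbar + 6 * (1 + β) * S.gap) / (β * S.gap)) ≤ (c.t : ℝ) then
    S.awgFail f g
  else
    { S with sub := c }

open Classical in
/-- The tests of gap reduction, made after a feasible outer iteration that has led to the subroutine
variables `c`. -/
def State.agrTest (S : State n) (c : Sub n) : State n :=
  if 2 * θ * S.gap / S.muhat ≤ ‖c.x - S.y‖ ^ 2 then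
    S.agrLower f θ
  else if f c.xhat - S.flow ≤ θ * S.gap then
    S.agrUpper f c.xhat
  else if ⌈Real.sqrt (6 * θ / (2 * θ - 1) +
      4 * c.Lbar * θ / (S.muhat * (2 * θ - 1)))⌉₊ ≤ c.t then
    S.agrFail f g
  else
    { S with sub := c }

/-- The state after an outer iteration of the running subroutine has reported `res`.  An infeasible
subproblem counts as an infinite distance `‖x^t - ȳ‖`. -/
def State.update (S : State n) (res : OneStepResult n) : State n :=
  match res with
  | .infeasible j =>
      let S' : State n := { S with calls := S.calls + j }
      match S.phase with
      | .awg => S'.awgSucceed β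
      | .agr => S'.agrLower f θ
  | .feasible xnew x Lt d =>
      let S' : State n := { S with calls := S.calls + m }
      let c := S.sub.advance f (S.level f θ β) xnew x Lt d
      match S.phase with
      | .awg => S'.awgTest f g β c
      | .agr => S'.agrTest f g θ c

/-- One transition of the algorithm: an outer iteration of the running subroutine, followed by its
tests and the resulting jump.  The relation is nondeterministic only through ties. -/
def Step (S S' : State n) : Prop :=
  ∃ res : OneStepResult n,
    OneStep X f g S.y (S.level f θ β) (alpha (S.sub.t + 1)) S.sub.xhat m S.sub.x res ∧
      S' = S.update f g m θ β res

end Main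

end

end RApex

/-! Projections of `ȳ` onto shrinking convex sets obey a Pythagorean inequality. Hence the squared
displacements add up to at most `‖x^t - ȳ‖²`, and every point of `X` at or below the level is at
least as far from `ȳ` as `x^t`. A large distance, or infeasibility, therefore certifies that the
level is reached only far away or not at all; convexity and quadratic growth turn this into a bound
on the optimality gap (`gap_le_of_far`).

Among `m + 1` points in `k ≤ m` pieces two share a piece, so the smallest local estimate is at most
`L` whenever progress is insufficient (`smoothEst_spec`). With the weights `ω_t` the recursion
telescopes to `ω_t (f x̂ - lvl) ≤ 3 (f ȳ - lvl) + L̄ ‖x - ȳ‖²` with `L̄ ≤ 4 L` (`Sub.Invariant`). As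
`ω_t > t² / 2`, gap reduction never returns false, and certificate generation returns false only
after finding a value below `f ȳ - Δ̃`. Since a gap estimate is valid once `μ̂ ≤ μ*`, quartering
happens only at `μ̂ > μ*`, so `μ̂ ≥ μ* / 4` and each call takes a multiple of `max 1 √(L / μ*)`
outer iterations.

Calls are counted through the product of modulus and gap estimates. Gap reduction multiplies it by
at most `θ`, certification does not increase it, a failure multiplies it by at most `9 (1 + β) / (4
θ)`, and it stays above a multiple of `μ* ε` until accuracy `ε` is reached. `State.remaining`
records this balance and `State.potential` converts it into gradient evaluations. -/

namespace RApex

/-! ### Consequences of quadratic growth -/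

section ProblemFacts

variable {n : ℕ} {X : Set (E n)} {f : E n → ℝ} {g : E n → E n} {μ : ℝ}

theorem optVal_eq {x : E n} (hx : x ∈ minimizers X f) : optVal X f = f x :=
  IsLeast.csInf_eq ⟨Set.mem_image_of_mem f hx.1, by rintro _ ⟨z, hz, rfl⟩; exact hx.2 z hz⟩

theorem optVal_le (hne : (minimizers X f).Nonempty) {x : E n} (hx : x ∈ X) :
    optVal X f ≤ f x := by
  obtain ⟨p, hp⟩ := hne
  rw [optVal_eq hp]
  exact hp.2 x hx

/-- Continuity of `f` is not assumed, but the oracle makes `f` the supremum of its affine minorants,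
attained at `z = x`; sublevel sets are thus cut out by closed half-spaces. -/
theorem isClosed_minimizers (hX : IsClosed X) (hg : IsSubgradientOracle X f g) :
    IsClosed (minimizers X f) := by
  have h : minimizers X f =
      X ∩ ⋂ z ∈ X, ⋂ w ∈ X, {x | f z + inner ℝ (g z) (x - z) ≤ f w} := by
    ext x
    simp only [minimizers, Set.mem_ofPred_eq, Set.mem_inter_iff, Set.mem_iInter]
    refine and_congr_right fun hx => ⟨fun h z hz w hw => (hg z hz x hx).trans (h w hw),
      fun h w hw => ?_⟩
    simpa using h x hx w hw
  rw [h]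
  refine hX.inter (isClosed_biInter fun z _ => isClosed_biInter fun w _ => ?_)
  exact isClosed_le (by fun_prop) continuous_const

theorem HasQuadraticGrowthModulus.growth (h : HasQuadraticGrowthModulus X f μ) {x : E n}
    (hx : x ∈ X) :
    μ * Metric.infDist x (minimizers X f) ^ 2 / 2 ≤ f x - optVal X f := by
  rcases eq_or_ne (Metric.infDist x (minimizers X f)) 0 with h0 | h0
  · have := optVal_le h.1 hx
    rw [h0]
    linarith
  · have hpos : 0 < Metric.infDist x (minimizers X f) ^ 2 := by positivity
    have : μ ≤ 2 * (f x - optVal X f) / Metric.infDist x (minimizers X f) ^ 2 := by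
      refine h.2.2 fun ν hν => ?_
      rw [le_div_iff₀ hpos]
      linarith [hν x hx]
    rw [le_div_iff₀ hpos] at this
    linarith

theorem HasQuadraticGrowthModulus.exists_minimizer (h : HasQuadraticGrowthModulus X f μ)
    (hX : IsClosed X) (hg : IsSubgradientOracle X f g) {x : E n} (hx : x ∈ X) :
    ∃ p ∈ minimizers X f, μ * ‖p - x‖ ^ 2 / 2 ≤ f x - optVal X f := by
  obtain ⟨p, hp, hd⟩ := (isClosed_minimizers hX hg).exists_infDist_eq_dist h.1 x
  refine ⟨p, hp, ?_⟩
  rw [← dist_eq_norm, dist_comm, ← hd]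
  exact h.growth hx

/-- The optimality gap is bounded through the subgradient. -/
theorem HasQuadraticGrowthModulus.mul_gap_le (h : HasQuadraticGrowthModulus X f μ) (hμ : 0 < μ)
    (hX : IsClosed X) (hg : IsSubgradientOracle X f g) {x : E n} (hx : x ∈ X) :
    μ * (f x - optVal X f) ≤ 2 * ‖g x‖ ^ 2 := by
  obtain ⟨p, hp, hd⟩ := h.exists_minimizer hX hg hx
  have h1 := hg x hx p hp.1
  have h2 := abs_le.1 (abs_real_inner_le_norm (g x) (p - x))
  rw [← optVal_eq hp] at h1
  have h3 : f x - optVal X f ≤ ‖g x‖ * ‖p - x‖ := by linarith [h2.1]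
  have h0 : 0 ≤ f x - optVal X f := sub_nonneg.2 (optVal_le h.1 hx)
  rcases h0.eq_or_lt with h0 | h0
  · rw [← h0]
    simp only [mul_zero]
    positivity
  · have h4 : (f x - optVal X f) ^ 2 ≤ ‖g x‖ ^ 2 * ‖p - x‖ ^ 2 := by
      rw [← mul_pow]
      exact pow_le_pow_left₀ h0.le h3 2
    have h5 : μ * (f x - optVal X f) ^ 2 ≤ ‖g x‖ ^ 2 * (2 * (f x - optVal X f)) := by
      calc μ * (f x - optVal X f) ^ 2 ≤ μ * (‖g x‖ ^ 2 * ‖p - x‖ ^ 2) := by gcongr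
        _ = ‖g x‖ ^ 2 * (μ * ‖p - x‖ ^ 2) := by ring
        _ ≤ _ := mul_le_mul_of_nonneg_left (by linarith) (by positivity)
    refine le_of_mul_le_mul_right ?_ h0
    linarith

/-- If every point of `X` at least `G` below `x` is far away, then the optimality gap at `x` is
bounded in terms of `G`. -/
theorem HasQuadraticGrowthModulus.gap_le_of_far (h : HasQuadraticGrowthModulus X f μ)
    (hμ : 0 < μ) (hX : IsClosed X) (hf : ConvexOn ℝ X f)
    (hg : IsSubgradientOracle X f g) {x : E n} (hx : x ∈ X) {G ν : ℝ} (hG : 0 < G)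
    (hν : 0 < ν) (hfar : ∀ z ∈ X, f z ≤ f x - G → 2 * G / ν ≤ ‖z - x‖ ^ 2) :
    f x - optVal X f ≤ max 1 (ν / μ) * G := by
  obtain ⟨p, hp, hd⟩ := h.exists_minimizer hX hg hx
  set D := f x - optVal X f with hD
  rcases le_or_gt D G with hDG | hDG
  · nlinarith [le_max_left 1 (ν / μ)]
  have hD0 : 0 < D := hG.trans hDG
  -- The fraction of the segment to the minimizer `p` at which convexity guarantees a decrease of
  -- `G`; that point must be far from `x`, which forces `s ≥ μ / ν`.
  set s := G / D with hs
  have hs0 : 0 < s := by positivity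
  have hs1 : s ≤ 1 := (div_le_one hD0).2 hDG.le
  have hsD : s * D = G := div_mul_cancel₀ _ hD0.ne'
  have hz : (1 - s) • x + s • p ∈ X :=
    hf.1 hx hp.1 (by linarith) hs0.le (by ring)
  have hfz := hf.2 hx hp.1 (sub_nonneg.2 hs1) hs0.le (by ring)
  have hzx : (1 - s) • x + s • p - x = s • (p - x) := by module
  have h1 := hfar _ hz (by
    refine hfz.trans (le_of_eq ?_)
    rw [← optVal_eq hp, smul_eq_mul, smul_eq_mul, ← hsD, hD]
    ring)
  rw [hzx, norm_smul, mul_pow, Real.norm_eq_abs, sq_abs] at h1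
  have h2 : 2 * G / ν * μ ≤ s ^ 2 * (2 * D) := by
    calc 2 * G / ν * μ ≤ s ^ 2 * ‖p - x‖ ^ 2 * μ := by gcongr
      _ = s ^ 2 * (μ * ‖p - x‖ ^ 2) := by ring
      _ ≤ _ := mul_le_mul_of_nonneg_left (by linarith) (by positivity)
  have h3 : G * (μ / ν) ≤ G * s := by
    have : s ^ 2 * (2 * D) = 2 * (G * s) := by rw [← hsD]; ring
    rw [this] at h2
    have e : 2 * G / ν * μ = 2 * (G * (μ / ν)) := by ring
    linarith
  have h4 : μ / ν ≤ s := le_of_mul_le_mul_left h3 hG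
  have h5 : D ≤ ν / μ * G := by
    rw [hs, div_le_div_iff₀ hν hD0] at h4
    rw [div_mul_eq_mul_div, le_div_iff₀ hμ]
    linarith
  exact h5.trans (by gcongr; exact le_max_right _ _)

end ProblemFacts

/-! ### Geometry of one outer iteration -/

section OneStepFacts

variable {n : ℕ} {X : Set (E n)} {f : E n → ℝ} {g : E n → E n}
  {y : E n} {lvl a : ℝ} {xhat : E n}

theorem inner_nonneg_of_isMin {S : Set (E n)} (hS : Convex ℝ S) {x : E n} (hx : x ∈ S)
    (hmin : ∀ z ∈ S, ‖x - y‖ ^ 2 ≤ ‖z - y‖ ^ 2) {z : E n} (hz : z ∈ S) :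
    0 ≤ (inner ℝ (z - x) (x - y) : ℝ) := by
  have : ‖y - x‖ = ⨅ w : S, ‖y - w‖ := by
    have : Nonempty S := ⟨⟨x, hx⟩⟩
    refine le_antisymm (le_ciInf fun w => ?_)
      (ciInf_le ⟨0, by rintro _ ⟨w, rfl⟩; exact norm_nonneg _⟩ (⟨x, hx⟩ : S))
    rw [norm_sub_rev y x, norm_sub_rev y]
    exact le_of_sq_le_sq (hmin w w.2) (norm_nonneg _)
  have h := (norm_eq_iInf_iff_real_inner_le_zero hS hx).1 this z hz
  rw [real_inner_comm, ← neg_sub y x, inner_neg_left]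
  linarith

theorem sq_norm_sub_le {x z : E n} (h : 0 ≤ (inner ℝ (z - x) (x - y) : ℝ)) :
    ‖z - x‖ ^ 2 ≤ ‖z - y‖ ^ 2 - ‖x - y‖ ^ 2 := by
  have : z - y = (z - x) + (x - y) := by abel
  rw [this, norm_add_sq_real]
  linarith

theorem convex_levelSet (hX : Convex ℝ X) (x : ℕ → E n) (i : ℕ) :
    Convex ℝ (levelSet X f g y lvl a xhat x i) := by
  intro u hu v hv s t hs ht hst
  refine ⟨hX hu.1 hv.1 hs ht hst, fun j hj => ?_, ?_⟩
  · have h1 := hu.2.1 j hj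
    have h2 := hv.2.1 j hj
    set w := mix a xhat (x j)
    have e : linearization f g (s • u + t • v) w =
        s * linearization f g u w + t * linearization f g v w := by
      have : s • u + t • v - w = s • (u - w) + t • (v - w) := by
        rw [← sub_eq_zero]
        calc _ = (s + t - 1) • w := by module
          _ = 0 := by rw [hst, sub_self, zero_smul]
      unfold linearization
      rw [this, inner_add_right, inner_smul_right, inner_smul_right]
      linear_combination (-f w) * hst
    rw [e]
    calc _ ≤ s * lvl + t * lvl := by gcongr
      _ = lvl := by rw [← add_mul, hst, one_mul]
  · have e : s • u + t • v - x 0 = s • (u - x 0) + t • (v - x 0) := by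
      rw [← sub_eq_zero]
      calc _ = (s + t - 1) • x 0 := by module
        _ = 0 := by rw [hst, sub_self, zero_smul]
    rw [e, inner_add_left, inner_smul_left, inner_smul_left]
    exact add_nonneg (mul_nonneg hs hu.2.2) (mul_nonneg ht hv.2.2)

theorem isClosed_levelSet (hX : IsClosed X) (x : ℕ → E n) (i : ℕ) :
    IsClosed (levelSet X f g y lvl a xhat x i) := by
  have : levelSet X f g y lvl a xhat x i = X ∩ ((⋂ j, ⋂ (_ : j < i),
      {z | linearization f g z (mix a xhat (x j)) ≤ lvl}) ∩
      {z | 0 ≤ (inner ℝ (z - x 0) (x 0 - y) : ℝ)}) := by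
    ext z
    simp only [levelSet, Set.mem_ofPred_eq, Set.mem_inter_iff, Set.mem_iInter]
  rw [this]
  unfold linearization
  refine hX.inter (IsClosed.inter (isClosed_iInter fun j => isClosed_iInter fun _ => ?_) ?_)
  · exact isClosed_le (by fun_prop) continuous_const
  · exact isClosed_le continuous_const (by fun_prop)

theorem levelSet_antitone (x : ℕ → E n) {i j : ℕ} (h : i ≤ j) :
    levelSet X f g y lvl a xhat x j ⊆ levelSet X f g y lvl a xhat x i :=
  fun _ hz => ⟨hz.1, fun k hk => hz.2.1 k (hk.trans_le h), hz.2.2⟩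

/-- Appending an iterate leaves the earlier subproblems unchanged, which allows the iterates to be
constructed one by one. -/
theorem levelSet_congr {x x' : ℕ → E n} {i : ℕ} (h0 : x 0 = x' 0) (h : ∀ j < i, x j = x' j) :
    levelSet X f g y lvl a xhat x i = levelSet X f g y lvl a xhat x' i := by
  ext z
  simp only [levelSet, Set.mem_ofPred_eq, h0]
  refine and_congr_right fun _ => and_congr_left fun _ =>
    forall_congr' fun j => forall_congr' fun hj => by rw [h j hj]

theorem mix_mem (hX : Convex ℝ X) (ha0 : 0 ≤ a) (ha1 : a ≤ 1) {u v : E n} (hu : u ∈ X)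
    (hv : v ∈ X) : mix a u v ∈ X :=
  hX hu hv (sub_nonneg.2 ha1) ha0 (by ring)

theorem linearization_mix (u v w : E n) :
    linearization f g (mix a u v) w =
      (1 - a) * linearization f g u w + a * linearization f g v w := by
  have : mix a u v - w = (1 - a) • (u - w) + a • (v - w) := by unfold mix; module
  unfold linearization
  rw [this, inner_add_right, inner_smul_right, inner_smul_right]
  ring

theorem exists_isMin_levelSet (hX : IsClosed X) (x : ℕ → E n) (i : ℕ)
    (h : (levelSet X f g y lvl a xhat x i).Nonempty) :
    ∃ p ∈ levelSet X f g y lvl a xhat x i,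
      ∀ z ∈ levelSet X f g y lvl a xhat x i, ‖p - y‖ ^ 2 ≤ ‖z - y‖ ^ 2 := by
  have hc : IsClosed (levelSet X f g y lvl a xhat x i) := isClosed_levelSet hX x i
  obtain ⟨p, hp, hd⟩ := hc.exists_infDist_eq_dist h y
  refine ⟨p, hp, fun z hz => ?_⟩
  rw [← dist_eq_norm, ← dist_eq_norm, dist_comm p, ← hd, dist_comm z]
  exact pow_le_pow_left₀ Metric.infDist_nonneg (Metric.infDist_le_dist_of_mem hz) 2

/-- An outer iteration can always be carried out. -/
theorem exists_oneStep (hX : IsClosed X) {m : ℕ} (hm : 1 ≤ m) (x0 : E n) :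
    ∃ res, OneStep X f g y lvl a xhat m x0 res := by
  have key : ∀ j ≤ m, (∃ res, OneStep X f g y lvl a xhat m x0 res) ∨
      ∃ x : ℕ → E n, x 0 = x0 ∧ SolvesSubproblems X f g y lvl a xhat x j := by
    intro j
    induction j with
    | zero => exact fun _ => Or.inr ⟨fun _ => x0, rfl, fun i h1 h2 => by omega⟩
    | succ j ih =>
      intro hj
      rcases ih (by omega) with h | ⟨x, hx0, hx⟩
      · exact Or.inl h
      rcases Set.eq_empty_or_nonempty (levelSet X f g y lvl a xhat x (j + 1)) with he | hne
      · exact Or.inl ⟨_, OneStep.infeasible x (j + 1) hx0 (by omega) hj hx he⟩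
      obtain ⟨p, hp, hmin⟩ := exists_isMin_levelSet hX x (j + 1) hne
      have hupd : ∀ i ≤ j, Function.update x (j + 1) p i = x i := fun i hi =>
        Function.update_of_ne (by omega) _ _
      refine Or.inr ⟨Function.update x (j + 1) p, by rw [hupd 0 (by omega), hx0], ?_⟩
      intro i h1 h2
      have hset : levelSet X f g y lvl a xhat (Function.update x (j + 1) p) i =
          levelSet X f g y lvl a xhat x i :=
        levelSet_congr (hupd 0 (by omega)) fun k hk => hupd k (by omega)
      rw [hset]
      rcases Nat.lt_or_ge i (j + 1) with h | h
      · rw [hupd i (by omega)]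
        exact hx i h1 (by omega)
      · obtain rfl : i = j + 1 := by omega
        rw [Function.update_self]
        exact ⟨hp, hmin⟩
  rcases key m le_rfl with h | ⟨x, hx0, hx⟩
  · exact h
  obtain ⟨xnew, hxm, hbest⟩ := Set.exists_min_image
    (insert xhat ((fun j => mix a xhat (x j)) '' Set.Icc 1 m)) f
    (((Set.finite_Icc 1 m).image _).insert _) (Set.insert_nonempty _ _)
  have hb : IsBestPoint f a xhat x m xnew := by
    refine ⟨?_, hbest _ (Set.mem_insert _ _), fun j h1 h2 =>
      hbest _ (Set.mem_insert_of_mem _ ⟨j, ⟨h1, h2⟩, rfl⟩)⟩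
    rcases hxm with h | ⟨j, hj, h⟩
    · exact Or.inl h
    · exact Or.inr ⟨j, hj.1, hj.2, h.symm⟩
  obtain ⟨⟨r, l⟩, hrl, hmin⟩ := Set.exists_min_image
    ({q | q.2 < q.1 ∧ q.1 ≤ m} : Set (ℕ × ℕ))
    (fun q => smoothEst f lvl a xhat x xnew q.1 q.2)
    (((Set.finite_Iic m).prod (Set.finite_Iic m)).subset fun q hq =>
      ⟨hq.2, (hq.1.le.trans hq.2 : q.2 ≤ m)⟩)
    ⟨(1, 0), by simpa using hm⟩
  exact ⟨_, OneStep.feasible x xnew r l hx0 hx hb hrl.1 hrl.2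
    fun r' l' h1 h2 => hmin (r', l') ⟨h1, h2⟩⟩

/-- Linearizations minorize `f`, so no cut removes a point at or below the level. -/
theorem mem_levelSet_of_le (hX : Convex ℝ X) (hg : IsSubgradientOracle X f g) (ha0 : 0 ≤ a)
    (ha1 : a ≤ 1) (hxhat : xhat ∈ X) {x : ℕ → E n} {i : ℕ} (hx : ∀ j < i, x j ∈ X)
    (hsep : ∀ z ∈ X, f z ≤ lvl → 0 ≤ (inner ℝ (z - x 0) (x 0 - y) : ℝ))
    {z : E n} (hz : z ∈ X) (hfz : f z ≤ lvl) : z ∈ levelSet X f g y lvl a xhat x i :=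
  ⟨hz, fun j hj => (hg _ (mix_mem hX ha0 ha1 hxhat (hx j hj)) z hz).trans hfz, hsep z hz hfz⟩

theorem SolvesSubproblems.mem {x : ℕ → E n} {j : ℕ}
    (h : SolvesSubproblems X f g y lvl a xhat x j) (h0 : x 0 ∈ X) {i : ℕ} (hi : i ≤ j) :
    x i ∈ X := by
  rcases Nat.eq_zero_or_pos i with rfl | hi0
  · exact h0
  · exact (h i hi0 hi).1.1

/-- The sets shrink, so a later iterate lies in the set onto which `x i` projects `y`; for `i = 0`
the half-space constraint takes over this role. -/
theorem SolvesSubproblems.sq_norm_sub_le {x : ℕ → E n} {m : ℕ} (hX : Convex ℝ X)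
    (h : SolvesSubproblems X f g y lvl a xhat x m) {i j : ℕ} (hij : i ≤ j) (hj : j ≤ m) :
    ‖x j - x i‖ ^ 2 ≤ ‖x j - y‖ ^ 2 - ‖x i - y‖ ^ 2 := by
  rcases hij.eq_or_lt with rfl | hij
  · simp
  apply RApex.sq_norm_sub_le
  have hj' := (h j (by omega) hj).1
  rcases Nat.eq_zero_or_pos i with rfl | hi
  · exact hj'.2.2
  · obtain ⟨h1, h2⟩ := h i hi (by omega)
    exact inner_nonneg_of_isMin (convex_levelSet hX x i) h1 h2 (levelSet_antitone x hij.le hj')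

/-- The linearization is affine: at `xhat` it minorizes `f`, and at `x r` the cut generated from `x
l` bounds it by the level. -/
theorem SolvesSubproblems.linearization_le {x : ℕ → E n} {m : ℕ} (hX : Convex ℝ X)
    (hg : IsSubgradientOracle X f g) (ha0 : 0 ≤ a) (ha1 : a ≤ 1) (hxhat : xhat ∈ X)
    (h0 : x 0 ∈ X) (h : SolvesSubproblems X f g y lvl a xhat x m) {l r : ℕ} (hlr : l < r)
    (hr : r ≤ m) :
    linearization f g (mix a xhat (x r)) (mix a xhat (x l)) ≤ (1 - a) * f xhat + a * lvl := by
  have hl := mix_mem hX ha0 ha1 hxhat (h.mem h0 (hlr.le.trans hr))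
  rw [linearization_mix]
  exact add_le_add (mul_le_mul_of_nonneg_left (hg _ hl _ hxhat) (sub_nonneg.2 ha1))
    (mul_le_mul_of_nonneg_left ((h r (by omega) hr).1.2.1 l hlr) ha0)

/-- The local smoothness estimate at an outer iteration of insufficient progress. -/
theorem smoothEst_spec {x : ℕ → E n} {m k r l : ℕ} {L : ℝ} {xnew : E n} (hX : Convex ℝ X)
    (hg : IsSubgradientOracle X f g) (hpws : IsPiecewiseSmooth X f g k L) (hkm : k ≤ m)
    (ha0 : 0 < a) (ha1 : a ≤ 1) (hxhat : xhat ∈ X)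
    (h0 : x 0 ∈ X) (h : SolvesSubproblems X f g y lvl a xhat x m)
    (hbest : IsBestPoint f a xhat x m xnew) (hlr : l < r) (hr : r ≤ m)
    (hargmin : ∀ r' l', l' < r' → r' ≤ m →
      smoothEst f lvl a xhat x xnew r l ≤ smoothEst f lvl a xhat x xnew r' l')
    (hev : (1 - a / 2) * (f xhat - lvl) < f xnew - lvl) :
    0 ≤ smoothEst f lvl a xhat x xnew r l ∧ smoothEst f lvl a xhat x xnew r l ≤ L ∧
      f xnew - lvl ≤ (1 - a / 2) * (f xhat - lvl) +
        a ^ 2 * smoothEst f lvl a xhat x xnew r l * ‖x r - x l‖ ^ 2 / 2 := by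
  have hδ : 0 < f xhat - lvl := by
    have := hbest.2.1
    nlinarith
  -- The factor `1 - 3a/4` lies strictly between `1 - a`, supplied by the cuts, and `1 - a/2`, used
  -- in the event.
  have hnum : 0 < (f xnew - lvl) - (1 - 3 / 4 * a) * (f xhat - lvl) := by nlinarith
  obtain ⟨hL, P, hP, hsm⟩ := hpws
  have hmem : ∀ i ≤ m, mix a xhat (x i) ∈ X := fun i hi => mix_mem hX ha0.le ha1 hxhat (h.mem h0 hi)
  -- If two iterates coincided, the cut would bound the new value itself and give progress by the
  -- factor `1 - a`, against the event. Hence no quotient in the minimum takes the default value.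
  have hd : ∀ r' l', l' < r' → r' ≤ m → x r' ≠ x l' := by
    intro r' l' h1 h2 he
    have h3 := h.linearization_le hX hg ha0.le ha1 hxhat h0 h1 h2
    have h4 := hbest.2.2 r' (by omega) h2
    rw [he] at h3 h4
    simp only [linearization, sub_self, inner_zero_right, add_zero] at h3
    nlinarith
  have hden : ∀ r' l', l' < r' → r' ≤ m → 0 < a ^ 2 / 2 * ‖x r' - x l'‖ ^ 2 := by
    intro r' l' h1 h2
    have := norm_pos_iff.2 (sub_ne_zero.2 (hd r' l' h1 h2))
    positivity
  refine ⟨(div_pos hnum (hden r l hlr hr)).le, ?_, ?_⟩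
  · have hc : ∀ i : Fin (m + 1), ∃ p : Fin k, mix a xhat (x i) ∈ P p := fun i => by
      have := hmem i (by omega)
      rw [← hP] at this
      simpa using this
    choose c hc using hc
    -- Pigeonhole: `m + 1` points, at most `m` pieces.
    obtain ⟨i, j, hij, hcij⟩ := Fintype.exists_ne_map_eq_of_card_lt c (by simp; omega)
    have main : ∀ i j : Fin (m + 1), i < j → c i = c j →
        smoothEst f lvl a xhat x xnew r l ≤ L := by
      intro i j hij hcij
      have hj : (j : ℕ) ≤ m := by omega
      refine (hargmin j i hij hj).trans ?_
      rw [smoothEst, div_le_iff₀ (hden j i hij hj)]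
      have h1 := hsm (c i) _ (hcij ▸ hc j) _ (hc i)
      have h2 := h.linearization_le hX hg ha0.le ha1 hxhat h0 hij hj
      have h3 := hbest.2.2 j (by have : (i : ℕ) < j := hij; omega) hj
      have h4 : mix a xhat (x j) - mix a xhat (x i) = a • (x j - x i) := by unfold mix; module
      rw [h4, norm_smul, mul_pow, Real.norm_eq_abs, sq_abs] at h1
      nlinarith
    rcases lt_or_gt_of_ne hij with h1 | h1
    · exact main i j h1 hcij
    · exact main j i h1 hcij.symm
  · have e : smoothEst f lvl a xhat x xnew r l * (a ^ 2 / 2 * ‖x r - x l‖ ^ 2) =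
        (f xnew - lvl) - (1 - 3 / 4 * a) * (f xhat - lvl) :=
      div_mul_cancel₀ _ (hden r l hlr hr).ne'
    nlinarith

end OneStepFacts

/-! ### The weights -/

theorem alpha_succ_pos (t : ℕ) : 0 < alpha (t + 1) := by
  unfold alpha
  positivity

theorem alpha_succ_le_one (t : ℕ) : alpha (t + 1) ≤ 1 := by
  unfold alpha
  rw [div_le_one (by positivity)]
  push_cast
  linarith [(Nat.cast_nonneg t : (0 : ℝ) ≤ t)]

theorem omega_pos (t : ℕ) : 0 < omega t := by
  unfold omega
  positivity

/-- This identity makes a recursion with contraction factor `1 - α_t / 2` telescope. -/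
theorem omega_succ_mul (t : ℕ) : omega (t + 1) * (1 - alpha (t + 1) / 2) = omega t := by
  unfold alpha omega
  push_cast
  field_simp
  ring

/-- The source of the `4` in `L̄ ≤ 4 L`. -/
theorem omega_mul_alpha_sq_le (t : ℕ) : omega t * alpha t ^ 2 / 2 ≤ 4 := by
  have : omega t * alpha t ^ 2 / 2 = 4 * (((t : ℝ) + 2) / (t + 3)) := by
    unfold alpha omega
    field_simp
    ring
  have h : ((t : ℝ) + 2) / (t + 3) ≤ 1 := by
    rw [div_le_one (by positivity)]
    linarith
  linarith

theorem sq_div_two_lt_omega (t : ℕ) : (t : ℝ) ^ 2 / 2 < omega t := by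
  unfold omega
  nlinarith [(Nat.cast_nonneg t : (0 : ℝ) ≤ t)]

/-! ### Invariants of a subroutine call -/

section Subroutine

variable {n : ℕ} {X : Set (E n)} {f : E n → ℝ} {g : E n → E n}
  {y : E n} {lvl L : ℝ} {c : Sub n}

/-- What holds in a subroutine called at `y` with level `lvl`, for a function of piecewise
smoothness constant `L`. -/
structure Sub.Invariant (X : Set (E n)) (f : E n → ℝ) (y : E n) (lvl L : ℝ) (c : Sub n) :
    Prop where
  xhat_mem : c.xhat ∈ X
  x_mem : c.x ∈ X
  f_xhat_le : f c.xhat ≤ f y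
  num_nonneg : 0 ≤ c.num
  num_le : c.num ≤ 4 * L * c.den
  den_nonneg : 0 ≤ c.den
  den_le : c.den ≤ ‖c.x - y‖ ^ 2
  omega_mul_le : omega c.t * (f c.xhat - lvl) ≤ 3 * (f y - lvl) + c.num
  sep : ∀ z ∈ X, f z ≤ lvl → 0 ≤ (inner ℝ (z - c.x) (c.x - y) : ℝ)

theorem Sub.Invariant.start (hy : y ∈ X) : (Sub.start y).Invariant X f y lvl L where
  xhat_mem := hy
  x_mem := hy
  f_xhat_le := le_rfl
  num_nonneg := le_rfl
  num_le := by simp [Sub.start]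
  den_nonneg := le_rfl
  den_le := by simp [Sub.start]
  omega_mul_le := by
    have : omega 0 = 3 := by norm_num [omega]
    simp [Sub.start, this]
  sep := by simp [Sub.start]

namespace Sub.Invariant

theorem Lbar_nonneg (h : c.Invariant X f y lvl L) : 0 ≤ c.Lbar :=
  div_nonneg h.num_nonneg h.den_nonneg

/-- A vanishing denominator forces a vanishing numerator, so the default value of the quotient is
harmless. -/
theorem Lbar_mul_den (h : c.Invariant X f y lvl L) : c.Lbar * c.den = c.num := by
  rcases h.den_nonneg.eq_or_lt with h0 | h0
  · have h1 := h.num_le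
    have h2 := h.num_nonneg
    rw [← h0, mul_zero] at h1 ⊢
    linarith
  · exact div_mul_cancel₀ _ h0.ne'

theorem Lbar_le (h : c.Invariant X f y lvl L) (hL : 0 < L) : c.Lbar ≤ 4 * L := by
  rcases h.den_nonneg.eq_or_lt with h0 | h0
  · rw [Sub.Lbar, ← h0, div_zero]
    positivity
  · exact (div_le_iff₀ h0).2 h.num_le

theorem omega_mul_le_Lbar (h : c.Invariant X f y lvl L) :
    omega c.t * (f c.xhat - lvl) ≤ 3 * (f y - lvl) + c.Lbar * ‖c.x - y‖ ^ 2 := by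
  have h1 := h.omega_mul_le
  rw [← h.Lbar_mul_den] at h1
  linarith [mul_le_mul_of_nonneg_left h.den_le h.Lbar_nonneg]

theorem sq_norm_le (h : c.Invariant X f y lvl L) {z : E n} (hz : z ∈ X) (hfz : f z ≤ lvl) :
    ‖c.x - y‖ ^ 2 ≤ ‖z - y‖ ^ 2 := by
  linarith [sq_norm_sub_le (h.sep z hz hfz), sq_nonneg ‖z - c.x‖]

/-- If the level is not below the value at the reference point, the iterates do not move. -/
theorem norm_sub_eq_zero (h : c.Invariant X f y lvl L) (hy : y ∈ X) (hle : f y ≤ lvl) :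
    ‖c.x - y‖ = 0 := by
  have := h.sq_norm_le hy hle
  rw [sub_self, norm_zero, zero_pow two_ne_zero] at this
  exact pow_eq_zero_iff two_ne_zero |>.1 (le_antisymm this (sq_nonneg _))

theorem Lbar_eq_zero (h : c.Invariant X f y lvl L) (hy : y ∈ X) (hle : f y ≤ lvl) :
    c.Lbar = 0 := by
  have h1 := h.den_le
  rw [h.norm_sub_eq_zero hy hle, zero_pow two_ne_zero] at h1
  rw [Sub.Lbar, le_antisymm h1 h.den_nonneg, div_zero]

theorem lt_of_infeasible (h : c.Invariant X f y lvl L) (hX : Convex ℝ X)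
    (hg : IsSubgradientOracle X f g) {m j : ℕ}
    (hstep : OneStep X f g y lvl (alpha (c.t + 1)) c.xhat m c.x (.infeasible j))
    {z : E n} (hz : z ∈ X) : lvl < f z := by
  rcases hstep with _ | ⟨x, _, h_start, h_pos, h_im, h_solves, h_empty⟩
  by_contra! hfz
  have h0 : x 0 ∈ X := h_start ▸ h.x_mem
  have : z ∈ levelSet X f g y lvl (alpha (c.t + 1)) c.xhat x j :=
    mem_levelSet_of_le hX hg (alpha_succ_pos _).le (alpha_succ_le_one _) h.xhat_mem
      (fun i hi => h_solves.mem h0 (by omega)) (h_start ▸ h.sep) hz hfz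
  rw [h_empty] at this
  exact this

theorem advance (h : c.Invariant X f y lvl L) (hX : Convex ℝ X)
    (hg : IsSubgradientOracle X f g) {m k : ℕ} (hpws : IsPiecewiseSmooth X f g k L)
    (hkm : k ≤ m) (hm : 1 ≤ m) {xnew x : E n} {Lt d : ℝ}
    (hstep : OneStep X f g y lvl (alpha (c.t + 1)) c.xhat m c.x (.feasible xnew x Lt d)) :
    (c.advance f lvl xnew x Lt d).Invariant X f y lvl L := by
  rcases hstep with ⟨x, _, r, l, h_start, h_solves, h_best, h_lr, h_rm, h_argmin⟩
  have ha0 := alpha_succ_pos c.t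
  have ha1 := alpha_succ_le_one c.t
  set a := alpha (c.t + 1) with ha
  have h0 : x 0 ∈ X := h_start ▸ h.x_mem
  have hsep : ∀ z ∈ X, f z ≤ lvl → 0 ≤ (inner ℝ (z - x m) (x m - y) : ℝ) := by
    intro z hz hfz
    obtain ⟨h1, h2⟩ := h_solves m hm le_rfl
    exact inner_nonneg_of_isMin (convex_levelSet hX x m) h1 h2
      (mem_levelSet_of_le hX hg ha0.le ha1 h.xhat_mem (fun i hi => h_solves.mem h0 hi.le)
        (h_start ▸ h.sep) hz hfz)
  have hxnew : xnew ∈ X := by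
    rcases h_best.1 with e | ⟨j, _, hj, e⟩
    · exact e ▸ h.xhat_mem
    · exact e ▸ mix_mem hX ha0.le ha1 h.xhat_mem (h_solves.mem h0 hj)
  -- Three Pythagorean inequalities along `x 0`, `x l`, `x r`, `x m`.
  have hdist : ‖x r - x l‖ ^ 2 ≤ ‖x m - y‖ ^ 2 - ‖c.x - y‖ ^ 2 := by
    have h1 := h_solves.sq_norm_sub_le hX h_lr.le h_rm
    have h2 := h_solves.sq_norm_sub_le hX h_rm le_rfl
    have h3 := h_solves.sq_norm_sub_le hX (Nat.zero_le l) (h_lr.le.trans h_rm)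
    rw [h_start] at h3
    linarith [sq_nonneg ‖x m - x r‖, sq_nonneg ‖x l - c.x‖]
  have hom := omega_succ_mul c.t
  have hop := omega_pos (c.t + 1)
  rw [← ha] at hom
  by_cases hev : (1 - a / 2) * (f c.xhat - lvl) < f xnew - lvl
  · obtain ⟨hLt0, hLt, hdec⟩ := smoothEst_spec hX hg hpws hkm ha0 ha1 h.xhat_mem h0 h_solves
      h_best h_lr h_rm h_argmin hev
    set Lt := smoothEst f lvl a c.xhat x xnew r l
    have hoa := omega_mul_alpha_sq_le (c.t + 1)
    rw [← ha] at hoa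
    refine ⟨hxnew, h_solves.mem h0 le_rfl, h_best.2.1.trans h.f_xhat_le, ?_, ?_, ?_, ?_, ?_, hsep⟩
    · simp only [Sub.advance, ← ha, if_pos hev]
      have := h.num_nonneg
      positivity
    · simp only [Sub.advance, ← ha, if_pos hev]
      have h1 : omega (c.t + 1) * a ^ 2 * Lt * ‖x r - x l‖ ^ 2 / 2 ≤ 4 * L * ‖x r - x l‖ ^ 2 := by
        calc _ = (omega (c.t + 1) * a ^ 2 / 2) * Lt * ‖x r - x l‖ ^ 2 := by ring
          _ ≤ _ := by gcongr
      linarith [h.num_le]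
    · simp only [Sub.advance, ← ha, if_pos hev]
      have := h.den_nonneg
      positivity
    · simp only [Sub.advance, ← ha, if_pos hev]
      linarith [h.den_le]
    · simp only [Sub.advance, ← ha, if_pos hev]
      have h1 := mul_le_mul_of_nonneg_left hdec hop.le
      have h2 := h.omega_mul_le
      rw [← hom] at h2
      linarith
  · refine ⟨hxnew, h_solves.mem h0 le_rfl, h_best.2.1.trans h.f_xhat_le, ?_, ?_, ?_, ?_, ?_, hsep⟩
    · simpa only [Sub.advance, ← ha, if_neg hev, add_zero] using h.num_nonneg
    · simpa only [Sub.advance, ← ha, if_neg hev, add_zero] using h.num_le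
    · simpa only [Sub.advance, ← ha, if_neg hev, add_zero] using h.den_nonneg
    · simp only [Sub.advance, ← ha, if_neg hev, add_zero]
      linarith [h.den_le, sq_nonneg ‖x r - x l‖]
    · simp only [Sub.advance, ← ha, if_neg hev, add_zero]
      have h1 := mul_le_mul_of_nonneg_left (not_lt.1 hev) hop.le
      have h2 := h.omega_mul_le
      rw [← hom] at h2
      linarith

/-- When certificate generation fails, the gap estimate is too small. -/
theorem lt_of_awg_fails {Δ β ρ : ℝ} (h : c.Invariant X f y (f y - (1 + β) * Δ) L)
    (hΔ : 0 < Δ) (hβ : 0 < β) (hdist : ‖c.x - y‖ ≤ ρ)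
    (htest : c.Lbar * ‖c.x - y‖ ^ 2 < omega c.t * β * Δ - 3 * (1 + β) * Δ ∨
      Real.sqrt ((2 * ρ ^ 2 * c.Lbar + 6 * (1 + β) * Δ) / (β * Δ)) ≤ (c.t : ℝ)) :
    f c.xhat < f y - Δ := by
  have h1 := h.omega_mul_le_Lbar
  have ho := omega_pos c.t
  -- The time test implies the first test, by `t² / 2 < ω_t` and the bound `ρ` on the distance.
  have key : c.Lbar * ‖c.x - y‖ ^ 2 < omega c.t * β * Δ - 3 * (1 + β) * Δ := by
    rcases htest with h2 | h2
    · exact h2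
    · have h3 := (Real.sqrt_le_left (Nat.cast_nonneg _)).1 h2
      rw [div_le_iff₀ (by positivity)] at h3
      have h4 : ‖c.x - y‖ ^ 2 ≤ ρ ^ 2 := pow_le_pow_left₀ (norm_nonneg _) hdist 2
      have h5 := mul_le_mul_of_nonneg_left h4 h.Lbar_nonneg
      have h6 := mul_lt_mul_of_pos_right (sq_div_two_lt_omega c.t) (mul_pos hβ hΔ)
      linarith
  have h2 : omega c.t * (f c.xhat - (f y - (1 + β) * Δ)) < omega c.t * (β * Δ) := by linarith
  have h3 := lt_of_mul_lt_mul_left h2 ho.le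
  linarith

/-- Gap reduction never fails. -/
theorem le_of_agr_test {Δ θ μ : ℝ} (h : c.Invariant X f y (f y - θ * Δ) L)
    (hΔ : 0 < Δ) (hθ : 1 / 2 < θ) (hμ : 0 < μ) (hdist : ‖c.x - y‖ ^ 2 < 2 * θ * Δ / μ)
    (htest : Real.sqrt (6 * θ / (2 * θ - 1) + 4 * c.Lbar * θ / (μ * (2 * θ - 1))) ≤ (c.t : ℝ)) :
    f c.xhat - (f y - Δ) ≤ θ * Δ := by
  have h1 := h.omega_mul_le_Lbar
  have ho := omega_pos c.t
  have hθ' : 0 < 2 * θ - 1 := by linarith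
  have h3 := (Real.sqrt_le_left (Nat.cast_nonneg _)).1 htest
  have h4 : (6 * θ / (2 * θ - 1) + 4 * c.Lbar * θ / (μ * (2 * θ - 1))) * ((2 * θ - 1) * Δ) =
      6 * (θ * Δ) + 2 * (c.Lbar * (2 * θ * Δ / μ)) := by
    generalize 2 * θ - 1 = q at hθ'
    field_simp
    ring
  have h5 := mul_le_mul_of_nonneg_left hdist.le h.Lbar_nonneg
  have h6 := mul_le_mul_of_nonneg_right h3 (mul_pos hθ' hΔ).le
  have h7 := mul_lt_mul_of_pos_right (sq_div_two_lt_omega c.t) (mul_pos hθ' hΔ)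
  rw [h4] at h6
  -- The target `f y - (1 - θ) Δ` lies `(2θ - 1) Δ` above the level.
  have h2 : omega c.t * (f c.xhat - (f y - θ * Δ)) ≤ omega c.t * ((2 * θ - 1) * Δ) := by linarith
  have h8 := le_of_mul_le_mul_left h2 ho
  linarith

end Sub.Invariant

end Subroutine

/-! ### Standing assumptions and the length of a call -/

/-- The standing assumptions on the problem and on the number of inner steps. -/
structure Setting {n : ℕ} (X : Set (E n)) (f : E n → ℝ) (g : E n → E n) (m : ℕ) (L μ : ℝ) :
    Prop where
  convex : Convex ℝ X
  closed : IsClosed X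
  convexOn : ConvexOn ℝ X f
  oracle : IsSubgradientOracle X f g
  mu_pos : 0 < μ
  growth : HasQuadraticGrowthModulus X f μ
  pws : ∃ k ≤ m, IsPiecewiseSmooth X f g k L
  one_le : 1 ≤ m

theorem Setting.L_pos {n : ℕ} {X : Set (E n)} {f : E n → ℝ} {g : E n → E n} {m : ℕ} {L μ : ℝ}
    (h : Setting X f g m L μ) : 0 < L := by
  obtain ⟨k, -, hk⟩ := h.pws
  exact hk.1

/-- A bound for one plus the number of outer iterations of a subroutine. -/
noncomputable def timeBound (θ β L μ : ℝ) : ℝ :=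
  (Real.sqrt (70 * (1 + β) / β) + Real.sqrt (70 * θ / (2 * θ - 1))) *
    max 1 (Real.sqrt (L / μ)) + 1

theorem sqrt_le_mul_max {x A r : ℝ} (hA : 0 ≤ A) (h : x ≤ A * max 1 r) :
    Real.sqrt x ≤ Real.sqrt A * max 1 (Real.sqrt r) := by
  refine (Real.sqrt_le_sqrt h).trans (le_of_eq ?_)
  rw [Real.sqrt_mul hA, (Real.sqrt_monotone).map_max, Real.sqrt_one]

theorem div_le_sixteen_mul {l ν L μ : ℝ} (hl : l ≤ 4 * L) (hL : 0 < L) (hμ : 0 < μ)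
    (hν : μ / 4 ≤ ν) : l / ν ≤ 16 * (L / μ) := by
  calc l / ν ≤ 4 * L / ν := by gcongr; linarith
    _ ≤ 4 * L / (μ / 4) := by gcongr
    _ = _ := by field_simp; norm_num

theorem awg_time_le {θ β L μ l ν Δ : ℝ} (hβ : 0 < β) (hL : 0 < L)
    (hμ : 0 < μ) (hν : μ / 4 ≤ ν) (hl : l ≤ 4 * L) (hΔl : Δ ≤ 0 → l = 0) :
    Real.sqrt ((2 * Real.sqrt (2 * (1 + β) * Δ / ν) ^ 2 * l + 6 * (1 + β) * Δ) / (β * Δ)) ≤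
      timeBound θ β L μ - 1 := by
  have hM : (1 : ℝ) ≤ max 1 (L / μ) := le_max_left _ _
  have hν0 : 0 < ν := by linarith
  have h1 : Real.sqrt ((2 * Real.sqrt (2 * (1 + β) * Δ / ν) ^ 2 * l + 6 * (1 + β) * Δ) / (β * Δ)) ≤
      Real.sqrt (70 * (1 + β) / β) * max 1 (Real.sqrt (L / μ)) := by
    apply sqrt_le_mul_max (by positivity)
    have hc : 0 ≤ (1 + β) / β := by positivity
    -- The gap estimate can be nonpositive when the lower estimate of the optimum is wrong. Then `l
    -- = 0`; at `Δ = 0` the quotient is read as `0`.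
    rcases lt_trichotomy Δ 0 with h | h | h
    · rw [hΔl h.le]
      have e : (2 * Real.sqrt (2 * (1 + β) * Δ / ν) ^ 2 * 0 + 6 * (1 + β) * Δ) / (β * Δ) =
          6 * ((1 + β) / β) := by
        have := h.ne
        field_simp
        ring
      rw [e, mul_div_assoc]
      nlinarith
    · rw [h]
      simp only [mul_zero, div_zero]
      positivity
    · rw [Real.sq_sqrt (by positivity)]
      have e : (2 * (2 * (1 + β) * Δ / ν) * l + 6 * (1 + β) * Δ) / (β * Δ) =
          (1 + β) / β * (4 * (l / ν) + 6) := by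
        field_simp
        ring
      -- The bracket is at most `4 · 16 + 6 = 70` times `max 1 (L / μ)`.
      have h2 := div_le_sixteen_mul hl hL hμ hν
      have h3 : L / μ ≤ max 1 (L / μ) := le_max_right _ _
      rw [e, show 70 * (1 + β) / β * max 1 (L / μ) =
        (1 + β) / β * (70 * max 1 (L / μ)) by ring]
      gcongr
      linarith
  unfold timeBound
  have h2 : 0 ≤ Real.sqrt (70 * θ / (2 * θ - 1)) * max 1 (Real.sqrt (L / μ)) := by positivity
  linarith

theorem agr_time_le {θ β L μ l ν : ℝ} (hθ : 1 / 2 < θ) (hL : 0 < L)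
    (hμ : 0 < μ) (hν : μ / 4 ≤ ν) (hl : l ≤ 4 * L) :
    Real.sqrt (6 * θ / (2 * θ - 1) + 4 * l * θ / (ν * (2 * θ - 1))) ≤ timeBound θ β L μ - 1 := by
  have hM : (1 : ℝ) ≤ max 1 (L / μ) := le_max_left _ _
  have hν0 : 0 < ν := by linarith
  have hθ' : 0 < 2 * θ - 1 := by linarith
  have h1 : Real.sqrt (6 * θ / (2 * θ - 1) + 4 * l * θ / (ν * (2 * θ - 1))) ≤
      Real.sqrt (70 * θ / (2 * θ - 1)) * max 1 (Real.sqrt (L / μ)) := by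
    apply sqrt_le_mul_max (by positivity)
    have hc : 0 ≤ θ / (2 * θ - 1) := by positivity
    have e : 6 * θ / (2 * θ - 1) + 4 * l * θ / (ν * (2 * θ - 1)) =
        θ / (2 * θ - 1) * (4 * (l / ν) + 6) := by
      generalize 2 * θ - 1 = q at hθ'
      field_simp
      ring
    have h2 := div_le_sixteen_mul hl hL hμ hν
    have h3 : L / μ ≤ max 1 (L / μ) := le_max_right _ _
    rw [e, show 70 * θ / (2 * θ - 1) * max 1 (L / μ) =
      θ / (2 * θ - 1) * (70 * max 1 (L / μ)) by ring]
    gcongr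
    linarith
  unfold timeBound
  have h2 : 0 ≤ Real.sqrt (70 * (1 + β) / β) * max 1 (Real.sqrt (L / μ)) := by positivity
  linarith

theorem one_le_timeBound {θ β L μ : ℝ} : 1 ≤ timeBound θ β L μ := by
  have : 0 ≤ (Real.sqrt (70 * (1 + β) / β) + Real.sqrt (70 * θ / (2 * θ - 1))) *
    max 1 (Real.sqrt (L / μ)) := by positivity
  unfold timeBound
  linarith

/-- Turns a certificate into a lower bound on the product of modulus and gap estimates. -/
theorem mul_le_of_le_max_mul {D ν μ Δ : ℝ} (hμ : 0 < μ) (hν : μ / 4 ≤ ν) (hΔ : 0 ≤ Δ)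
    (h : D ≤ max 1 (ν / μ) * Δ) : μ * D ≤ 4 * (ν * Δ) := by
  have h1 : max 1 (ν / μ) ≤ 4 * ν / μ := by
    refine max_le ?_ (by gcongr; linarith)
    rw [le_div_iff₀ hμ]
    linarith
  calc μ * D ≤ μ * (4 * ν / μ * Δ) := by
        gcongr
        exact h.trans (by gcongr)
    _ = _ := by field_simp

/-! ### Invariant and potential of the restart scheme -/

section MainAlgorithm

variable {n : ℕ} {X : Set (E n)} {f : E n → ℝ} {g : E n → E n} {m : ℕ} {L μ θ β ε : ℝ}
  {S : State n}

/-- What holds along a run as long as the current solution is not optimal. -/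
structure State.Invariant (X : Set (E n)) (f : E n → ℝ) (g : E n → E n) (L μ θ β : ℝ)
    (S : State n) : Prop where
  y_mem : S.y ∈ X
  flow_eq : S.flow = f S.y - S.gap
  muhat_ge : μ / 4 ≤ S.muhat
  gap_valid : S.muhat ≤ μ → f S.y - optVal X f ≤ S.gap
  prev_valid : ∀ q, S.prev = some q →
    S.muhat ≤ q.1 ∧ f S.y - optVal X f ≤ max 1 (q.1 / μ) * q.2
  first : S.phase = .awg → S.prev = none → S.muhat * S.gap = 2 * ‖g S.y‖ ^ 2
  agr : S.phase = .agr → S.cert.1 = S.muhat ∧ S.gap ≤ S.cert.2 ∧ S.cert.2 ≤ (1 + β) * S.gap ∧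
    0 < S.gap ∧ f S.y - optVal X f ≤ max 1 (S.muhat / μ) * S.cert.2
  sub : S.sub.Invariant X f S.y (S.level f θ β) L
  time : (S.sub.t : ℝ) + 1 ≤ timeBound θ β L μ

/-- The product of modulus and gap estimates that drives the potential. -/
noncomputable def State.product (θ β : ℝ) (S : State n) : ℝ :=
  match S.phase, S.prev with
  | .awg, some q => max (θ * (q.1 * q.2) / (1 + β)) (S.muhat * S.gap)
  | _, _ => S.muhat * S.gap

/-- A lower bound for `State.product` while the accuracy `ε` is not reached. -/
noncomputable def minProduct (μ θ β ε : ℝ) : ℝ := θ * (μ * ε) / (4 * (1 + β))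

/-- A bound for the number of subroutine calls still to come. -/
noncomputable def State.remaining (μ θ β ε : ℝ) (S : State n) : ℝ :=
  2 * Real.log (S.product θ β / minProduct μ θ β ε) / -Real.log θ +
    (1 + 2 * Real.log (9 * (1 + β) / (4 * θ)) / -Real.log θ) * Real.logb 4 (4 * S.muhat / μ) +
    (match S.phase with | .awg => 1 | .agr => 0)

theorem State.product_awg_some (hp : S.phase = .awg) {q : ℝ × ℝ} (hq : S.prev = some q) :
    S.product θ β = max (θ * (q.1 * q.2) / (1 + β)) (S.muhat * S.gap) := by
  simp only [State.product, hp, hq]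

theorem State.product_none (hq : S.prev = none) : S.product θ β = S.muhat * S.gap := by
  rcases hp : S.phase with _ | _ <;> simp only [State.product, hp, hq]

theorem State.product_agr (hp : S.phase = .agr) : S.product θ β = S.muhat * S.gap := by
  simp only [State.product, hp]

theorem State.muhat_mul_gap_le_product : S.muhat * S.gap ≤ S.product θ β := by
  unfold State.product
  split
  · exact le_max_right _ _
  · exact le_rfl

theorem log_div_le {P P' M s : ℝ} (hP : 0 < P) (hP' : 0 < P') (hM : 0 < M) (hs : 0 < s)
    (h : P' ≤ s * P) : Real.log (P' / M) ≤ Real.log s + Real.log (P / M) := by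
  rw [← Real.log_mul hs.ne' (by positivity)]
  apply Real.log_le_log (by positivity)
  rw [← mul_div_assoc]
  gcongr

namespace State.Invariant

theorem muhat_pos (h : S.Invariant X f g L μ θ β) (hμ : 0 < μ) : 0 < S.muhat := by
  linarith [h.muhat_ge]

theorem prev_pos (h : S.Invariant X f g L μ θ β) (hμ : 0 < μ) (hD : 0 < f S.y - optVal X f)
    {q : ℝ × ℝ} (hq : S.prev = some q) : 0 < q.1 ∧ 0 < q.2 := by
  obtain ⟨h1, h2⟩ := h.prev_valid q hq
  refine ⟨(h.muhat_pos hμ).trans_le h1, ?_⟩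
  by_contra! h3
  have : max 1 (q.1 / μ) * q.2 ≤ 0 :=
    mul_nonpos_of_nonneg_of_nonpos (zero_le_one.trans (le_max_left _ _)) h3
  linarith

theorem minProduct_le (h : S.Invariant X f g L μ θ β) (hS : Setting X f g m L μ)
    (hθ : 0 < θ) (hθ1 : θ < 1) (hβ : 0 < β) (hε : 0 < ε) (hD : ε ≤ f S.y - optVal X f) :
    minProduct μ θ β ε ≤ S.product θ β := by
  have hμ := hS.mu_pos
  have hD0 := hε.trans_le hD
  have hμε : μ * ε ≤ μ * (f S.y - optVal X f) := by gcongr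
  have key : ∀ P, μ * (f S.y - optVal X f) ≤ 4 * (1 + β) * P → minProduct μ θ β ε ≤ P := by
    intro P hP
    rw [minProduct, div_le_iff₀ (by positivity)]
    have : 0 < μ * ε := by positivity
    nlinarith
  rcases hp : S.phase with _ | _
  · rcases hq : S.prev with _ | q
    · rw [State.product_none hq, h.first hp hq]
      apply key
      have := hS.growth.mul_gap_le hμ hS.closed hS.oracle h.y_mem
      nlinarith [sq_nonneg ‖g S.y‖]
    · rw [State.product_awg_some hp hq]
      -- The current gap estimate may be nonpositive here, so the bound comes from the preceding
      -- certificate.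
      refine le_trans ?_ (le_max_left _ _)
      have h1 := h.prev_valid q hq
      have h2 := mul_le_of_le_max_mul hμ (h.muhat_ge.trans h1.1) (h.prev_pos hμ hD0 hq).2.le h1.2
      rw [minProduct, div_le_div_iff₀ (by positivity) (by positivity)]
      have : θ * (μ * ε) ≤ θ * (4 * (q.1 * q.2)) := by
        exact mul_le_mul_of_nonneg_left (hμε.trans h2) hθ.le
      nlinarith
  · rw [State.product_agr hp]
    apply key
    obtain ⟨-, h1, h2, h3, h4⟩ := h.agr hp
    have h5 := mul_le_of_le_max_mul hμ h.muhat_ge (h3.le.trans h1) h4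
    have := h.muhat_pos hμ
    calc _ ≤ 4 * (S.muhat * S.cert.2) := h5
      _ ≤ 4 * (S.muhat * ((1 + β) * S.gap)) := by gcongr
      _ = _ := by ring

theorem one_le_rate (hθ : 0 < θ) (hθ1 : θ < 1) (hβ : 0 < β) : 1 ≤ 9 * (1 + β) / (4 * θ) := by
  rw [le_div_iff₀ (by positivity)]
  linarith

theorem remaining_nonneg (h : S.Invariant X f g L μ θ β) (hS : Setting X f g m L μ)
    (hθ : 0 < θ) (hθ1 : θ < 1) (hβ : 0 < β) (hε : 0 < ε) (hD : ε ≤ f S.y - optVal X f) :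
    0 ≤ S.remaining μ θ β ε := by
  have hμ := hS.mu_pos
  have hlog : 0 < -Real.log θ := neg_pos.2 (Real.log_neg hθ hθ1)
  have hmin : 0 < minProduct μ θ β ε := by unfold minProduct; positivity
  have h1 : 0 ≤ Real.log (S.product θ β / minProduct μ θ β ε) :=
    Real.log_nonneg ((one_le_div hmin).2 (h.minProduct_le hS hθ hθ1 hβ hε hD))
  have h2 : 0 ≤ Real.log (9 * (1 + β) / (4 * θ)) := Real.log_nonneg (one_le_rate hθ hθ1 hβ)
  have h3 : 0 ≤ Real.logb 4 (4 * S.muhat / μ) := by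
    apply Real.logb_nonneg (by norm_num)
    rw [le_div_iff₀ hμ]
    linarith [h.muhat_ge]
  unfold State.remaining
  refine add_nonneg (by positivity) ?_
  split <;> norm_num

/-- Passing to `S'` costs one subroutine call, if the product estimate decreases suitably. -/
theorem _root_.RApex.State.remaining_le_sub_one {S' : State n} (hθ : 0 < θ)
    (hθ1 : θ < 1)
    (hmu : S'.muhat = S.muhat) (hmin : 0 < minProduct μ θ β ε) (hP : 0 < S.product θ β)
    (hP' : 0 < S'.product θ β)
    (h : S.phase = .awg ∧ S'.phase = .agr ∧ S'.product θ β ≤ S.product θ β ∨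
      S.phase = .agr ∧ S'.product θ β ≤ θ * S.product θ β) :
    S'.remaining μ θ β ε ≤ S.remaining μ θ β ε - 1 := by
  have hlog : 0 < -Real.log θ := neg_pos.2 (Real.log_neg hθ hθ1)
  rcases h with ⟨h1, h2, h3⟩ | ⟨h1, h2⟩
  · have h4 := log_div_le hP hP' hmin one_pos (by rwa [one_mul])
    rw [Real.log_one, zero_add] at h4
    simp only [State.remaining, h1, h2, hmu]
    have h5 : 2 * Real.log (S'.product θ β / minProduct μ θ β ε) / -Real.log θ ≤
        2 * Real.log (S.product θ β / minProduct μ θ β ε) / -Real.log θ := by gcongr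
    linarith
  · have h4 := log_div_le hP hP' hmin hθ h2
    -- The potential drops by two units: one pays for this call, the other for a possible return to
    -- certificate generation.
    have h5 : 2 * Real.log (S'.product θ β / minProduct μ θ β ε) / -Real.log θ ≤
        2 * Real.log (S.product θ β / minProduct μ θ β ε) / -Real.log θ - 2 := by
      calc _ ≤ 2 * (Real.log θ + Real.log (S.product θ β / minProduct μ θ β ε)) / -Real.log θ := by
            gcongr
        _ = _ := by
            have := hlog.ne'
            rw [neg_ne_zero] at this
            field_simp
            ring
    have h6 : (match S'.phase with | .awg => (1 : ℝ) | .agr => 0) ≤ 1 := by split <;> norm_num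
    simp only [State.remaining, h1, hmu]
    linarith

theorem withCalls (h : S.Invariant X f g L μ θ β) (j : ℕ) :
    State.Invariant X f g L μ θ β { S with calls := j } :=
  ⟨h.y_mem, h.flow_eq, h.muhat_ge, h.gap_valid, h.prev_valid, h.first, h.agr, h.sub, h.time⟩

/-- A failure of certificate generation, at a modulus estimate that is too large. -/
theorem awgFail (h : S.Invariant X f g L μ θ β) (hS : Setting X f g m L μ)
    (hθ : 0 < θ) (hθ1 : θ < 1) (hβ : 0 < β) (hε : 0 < ε) (hD : ε ≤ f S.y - optVal X f)
    (hp : S.phase = .awg) (hmu : μ < S.muhat) :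
    (S.awgFail f g).Invariant X f g L μ θ β ∧
      (S.awgFail f g).remaining μ θ β ε ≤ S.remaining μ θ β ε - 1 := by
  have hμ := hS.mu_pos
  have hD0 := hε.trans_le hD
  have hmu0 := h.muhat_pos hμ
  have hlog : 0 < -Real.log θ := neg_pos.2 (Real.log_neg hθ hθ1)
  have hmin : 0 < minProduct μ θ β ε := by unfold minProduct; positivity
  have hgrad := hS.growth.mul_gap_le hμ hS.closed hS.oracle h.y_mem
  have hgradGap : S.muhat / 4 ≤ μ → f S.y - optVal X f ≤ 2 / (S.muhat / 4) * ‖g S.y‖ ^ 2 := by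
    intro h1
    rw [div_mul_eq_mul_div, le_div_iff₀ (by positivity)]
    nlinarith
  have hc := one_le_rate hθ hθ1 hβ
  have hc0 : 0 < 9 * (1 + β) / (4 * θ) := by positivity
  refine ⟨⟨h.y_mem, rfl, ?_, ?_, ?_, ?_, ?_, Sub.Invariant.start h.y_mem, ?_⟩, ?_⟩
  · change μ / 4 ≤ S.muhat / 4
    linarith
  · intro h1
    change S.muhat / 4 ≤ μ at h1
    change f S.y - optVal X f ≤ transferMin S.prev (S.muhat / 4) (2 / (S.muhat / 4) * ‖g S.y‖ ^ 2)
    rcases hq : S.prev with _ | q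
    · exact hgradGap h1
    · refine le_min ?_ (hgradGap h1)
      obtain ⟨h2, h3⟩ := h.prev_valid q hq
      obtain ⟨h4, h5⟩ := h.prev_pos hμ hD0 hq
      -- The transferred gap is valid because `μ̂ / 4 ≤ μ` and `μ̂ ≤ μ_{s-1}`; of the factor `9/4`
      -- only that it is at least `1` matters.
      refine h3.trans (mul_le_mul_of_nonneg_right (max_le ?_ ?_) h5.le)
      · rw [le_div_iff₀ (by positivity)]
        linarith
      · rw [div_le_div_iff₀ hμ (by positivity)]
        nlinarith
  · intro q hq
    have := h.prev_valid q hq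
    exact ⟨(by change S.muhat / 4 ≤ q.1; linarith [this.1]), this.2⟩
  · intro _ hq
    change S.prev = none at hq
    change S.muhat / 4 * transferMin S.prev (S.muhat / 4) (2 / (S.muhat / 4) * ‖g S.y‖ ^ 2) = _
    rw [hq]
    change S.muhat / 4 * (2 / (S.muhat / 4) * ‖g S.y‖ ^ 2) = 2 * ‖g S.y‖ ^ 2
    field_simp
  · exact fun h1 => nomatch h1
  · simpa [State.awgFail, State.requarter, Sub.start] using one_le_timeBound
  · have hP := hmin.trans_le (h.minProduct_le hS hθ hθ1 hβ hε hD)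
    have hP' : 0 < (S.awgFail f g).product θ β ∧
        (S.awgFail f g).product θ β ≤ 9 * (1 + β) / (4 * θ) * S.product θ β := by
      rcases hq : S.prev with _ | q
      -- Before any certificate the product is `2 ‖g ȳ‖²`, whatever `μ̂` is.
      · have e : (S.awgFail f g).product θ β = S.product θ β := by
          rw [State.product_none (S := S.awgFail f g) hq, State.product_none hq, h.first hp hq]
          simp only [State.awgFail, State.requarter, hq, transferMin]
          field_simp
        rw [e]
        exact ⟨hP, le_mul_of_one_le_left hP.le hc⟩
      · obtain ⟨h4, h5⟩ := h.prev_pos hμ hD0 hq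
        have h6 : θ * (q.1 * q.2) / (1 + β) ≤ S.product θ β := by
          rw [State.product_awg_some hp hq]
          exact le_max_left _ _
        -- The new product is at most `9/4` times that of the last certificate, the old one at least
        -- `θ / (1 + β)` times it; the ratio is the growth factor.
        have h7 : 9 / 4 * (q.1 * q.2) ≤ 9 * (1 + β) / (4 * θ) * S.product θ β := by
          calc 9 / 4 * (q.1 * q.2) = 9 * (1 + β) / (4 * θ) * (θ * (q.1 * q.2) / (1 + β)) := by
                field_simp
            _ ≤ _ := by gcongr
        rw [State.product_awg_some (S := S.awgFail f g) rfl hq]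
        refine ⟨lt_max_of_lt_left (by positivity), (max_le ?_ ?_).trans h7⟩
        · rw [div_le_iff₀ (by positivity)]
          have : 0 < q.1 * q.2 := by positivity
          nlinarith [mul_pos this hβ]
        · simp only [State.awgFail, State.requarter, hq, transferMin]
          calc _ ≤ S.muhat / 4 * (9 * q.1 / (4 * (S.muhat / 4)) * q.2) := by
                gcongr
                exact min_le_left _ _
            _ = _ := by field_simp
    have h4 := log_div_le hP hP'.1 hmin hc0 hP'.2
    have h5 : Real.logb 4 (4 * (S.muhat / 4) / μ) = Real.logb 4 (4 * S.muhat / μ) - 1 := by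
      have : 4 * (S.muhat / 4) / μ = (4 * S.muhat / μ) / 4 := by ring
      rw [this, Real.logb_div (by positivity) (by norm_num), Real.logb_self_eq_one (by norm_num)]
    have hp' : (S.awgFail f g).phase = .awg := rfl
    have hm' : (S.awgFail f g).muhat = S.muhat / 4 := rfl
    simp only [State.remaining, hp', hm', h5, hp]
    have h6 : 2 * Real.log ((S.awgFail f g).product θ β / minProduct μ θ β ε) / -Real.log θ ≤
        2 * Real.log (9 * (1 + β) / (4 * θ)) / -Real.log θ +
          2 * Real.log (S.product θ β / minProduct μ θ β ε) / -Real.log θ := by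
      rw [← add_div, ← mul_add]
      gcongr
    linarith

/-- A success of certificate generation. -/
theorem awgSucceed (h : S.Invariant X f g L μ θ β) (hS : Setting X f g m L μ)
    (hθ : 0 < θ) (hθ1 : θ < 1) (hβ : 0 < β) (hε : 0 < ε) (hD : ε ≤ f S.y - optVal X f)
    (hp : S.phase = .awg) (hgap : 0 < S.gap)
    (hfar : ∀ z ∈ X, f z ≤ f S.y - (1 + β) * S.gap →
      2 * ((1 + β) * S.gap) / S.muhat ≤ ‖z - S.y‖ ^ 2) :
    (S.awgSucceed β).Invariant X f g L μ θ β ∧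
      (S.awgSucceed β).remaining μ θ β ε ≤ S.remaining μ θ β ε - 1 := by
  have hμ := hS.mu_pos
  have hmu0 := h.muhat_pos hμ
  have hmin : 0 < minProduct μ θ β ε := by unfold minProduct; positivity
  refine ⟨⟨h.y_mem, h.flow_eq, h.muhat_ge, h.gap_valid, h.prev_valid, ?_, fun _ => ?_,
    Sub.Invariant.start h.y_mem, ?_⟩, ?_⟩
  · exact fun h1 => nomatch h1
  · refine ⟨rfl, ?_, le_rfl, hgap, ?_⟩
    · change S.gap ≤ (1 + β) * S.gap
      nlinarith
    · exact hS.growth.gap_le_of_far hμ hS.closed hS.convexOn hS.oracle h.y_mem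
        (mul_pos (by linarith) hgap) hmu0 hfar
  · simpa [State.awgSucceed, Sub.start] using one_le_timeBound
  · have hpr : (S.awgSucceed β).product θ β = S.muhat * S.gap := rfl
    exact State.remaining_le_sub_one hθ hθ1 rfl hmin
      (hmin.trans_le (h.minProduct_le hS hθ hθ1 hβ hε hD)) (hpr ▸ mul_pos hmu0 hgap)
      (Or.inl ⟨hp, rfl, hpr ▸ State.muhat_mul_gap_le_product⟩)

/-- Gap reduction improves the lower bound. -/
theorem agrLower (h : S.Invariant X f g L μ θ β) (hS : Setting X f g m L μ)
    (hθ : 0 < θ) (hθ1 : θ < 1) (hβ : 0 < β)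
    (hε : 0 < ε) (hp : S.phase = .agr)
    (hfar : ∀ z ∈ X, f z ≤ f S.y - θ * S.gap →
      2 * (θ * S.gap) / S.muhat ≤ ‖z - S.y‖ ^ 2) :
    (S.agrLower f θ).Invariant X f g L μ θ β ∧
      (S.agrLower f θ).remaining μ θ β ε ≤ S.remaining μ θ β ε - 1 := by
  have hμ := hS.mu_pos
  have hmu0 := h.muhat_pos hμ
  have hmin : 0 < minProduct μ θ β ε := by unfold minProduct; positivity
  obtain ⟨-, -, -, hgap, -⟩ := h.agr hp
  have hgap' : 0 < θ * S.gap := by positivity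
  have hcert := hS.growth.gap_le_of_far hμ hS.closed hS.convexOn hS.oracle h.y_mem hgap'
    hmu0 hfar
  have hp' : (S.agrLower f θ).phase = .agr := hp
  refine ⟨⟨h.y_mem, rfl, h.muhat_ge, fun h1 => ?_, h.prev_valid, ?_, fun _ => ?_,
    Sub.Invariant.start h.y_mem, ?_⟩, ?_⟩
  · change S.muhat ≤ μ at h1
    -- For `μ̂ ≤ μ` the certificate bounds the gap without loss.
    rw [max_eq_left ((div_le_one hμ).2 h1), one_mul] at hcert
    exact hcert
  · exact fun h1 => nomatch hp'.symm.trans h1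
  · refine ⟨rfl, le_rfl, ?_, hgap', hcert⟩
    change θ * S.gap ≤ (1 + β) * (θ * S.gap)
    nlinarith
  · simpa [State.agrLower, Sub.start] using one_le_timeBound
  · have hpr : (S.agrLower f θ).product θ β = S.muhat * (θ * S.gap) := State.product_agr hp'
    have hpr0 : S.product θ β = S.muhat * S.gap := State.product_agr hp
    exact State.remaining_le_sub_one hθ hθ1 rfl hmin
      (hpr0 ▸ mul_pos hmu0 hgap) (hpr ▸ mul_pos hmu0 hgap')
      (Or.inr ⟨hp, by rw [hpr, hpr0]; exact le_of_eq (by ring)⟩)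

/-- Gap reduction improves the upper bound. -/
theorem agrUpper (h : S.Invariant X f g L μ θ β) (hS : Setting X f g m L μ)
    (hθ : 0 < θ) (hθ1 : θ < 1) (hβ : 0 < β)
    (hε : 0 < ε) (hp : S.phase = .agr) {x : E n} (hx : x ∈ X) (hfx : f x ≤ f S.y)
    (htest : f x - S.flow ≤ θ * S.gap) :
    (S.agrUpper f x).Invariant X f g L μ θ β ∧
      (S.agrUpper f x).remaining μ θ β ε ≤ S.remaining μ θ β ε - 1 := by
  have hμ := hS.mu_pos
  have hmu0 := h.muhat_pos hμ
  have hmin : 0 < minProduct μ θ β ε := by unfold minProduct; positivity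
  obtain ⟨hc1, hc2, hc3, hgap, hc4⟩ := h.agr hp
  refine ⟨⟨hx, ?_, h.muhat_ge, fun h1 => ?_, fun q hq => ?_, ?_, ?_,
    Sub.Invariant.start hx, ?_⟩, ?_⟩
  · change S.flow = f x - (f x - S.flow)
    ring
  · have := h.gap_valid h1
    change f x - optVal X f ≤ f x - S.flow
    linarith [h.flow_eq]
  · obtain rfl : S.cert = q := Option.some.inj hq
    refine ⟨hc1.ge, ?_⟩
    rw [hc1]
    change f x - optVal X f ≤ _
    linarith
  · intro _ hq
    exact nomatch hq
  · exact fun h1 => nomatch h1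
  · simpa [State.agrUpper, Sub.start] using one_le_timeBound
  · have hpr : (S.agrUpper f x).product θ β =
        max (θ * (S.cert.1 * S.cert.2) / (1 + β)) (S.muhat * (f x - S.flow)) := rfl
    have hpr0 : S.product θ β = S.muhat * S.gap := State.product_agr hp
    have hc0 := hgap.trans_le hc2
    refine State.remaining_le_sub_one hθ hθ1 rfl hmin
      (hpr0 ▸ mul_pos hmu0 hgap) ?_ (Or.inr ⟨hp, ?_⟩)
    -- `f x - S.flow` may be nonpositive; the certificate term keeps the product positive.
    · rw [hpr, hc1]
      exact lt_max_of_lt_left (by positivity)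
    · rw [hpr, hpr0, hc1]
      -- The weight `θ / (1 + β)` of the certificate term matches `Δ_s ≤ (1 + β) Δ̃_s`, so both
      -- terms shrink by `θ`.
      refine max_le ?_ ?_
      · rw [div_le_iff₀ (by positivity)]
        calc θ * (S.muhat * S.cert.2) ≤ θ * (S.muhat * ((1 + β) * S.gap)) := by gcongr
          _ = _ := by ring
      · calc S.muhat * (f x - S.flow) ≤ S.muhat * (θ * S.gap) := by gcongr
          _ = _ := by ring

end State.Invariant

end MainAlgorithm

/-! ### Counting gradient evaluations along a run -/

section Run

variable {n : ℕ} {X : Set (E n)} {f : E n → ℝ} {g : E n → E n} {m : ℕ} {L μ θ β ε : ℝ}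
  {S : State n}

/-- `S'` arises from `S` by continuing or by ending the running subroutine, with at most `j`
gradient evaluations for the outer iteration. -/
def Progress (X : Set (E n)) (f : E n → ℝ) (g : E n → E n) (L μ θ β ε : ℝ) (j : ℕ)
    (S S' : State n) : Prop :=
  S'.Invariant X f g L μ θ β ∧
    (S'.calls ≤ S.calls + j ∧ S'.sub.t = S.sub.t + 1 ∧
        S'.remaining μ θ β ε = S.remaining μ θ β ε ∨
      S'.calls ≤ S.calls + j + 1 ∧ S'.sub.t = 0 ∧
        S'.remaining μ θ β ε ≤ S.remaining μ θ β ε - 1)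

namespace State.Invariant

theorem progress_awgTest (h : S.Invariant X f g L μ θ β) (hS : Setting X f g m L μ)
    (hθ : 0 < θ) (hθ1 : θ < 1) (hβ : 0 < β) (hε : 0 < ε) (hD : ε ≤ f S.y - optVal X f)
    (hp : S.phase = .awg) {c : Sub n}
    (hc : c.Invariant X f S.y (f S.y - (1 + β) * S.gap) L) (hct : c.t = S.sub.t + 1) :
    Progress X f g L μ θ β ε 0 S (S.awgTest f g β c) := by
  have hμ := hS.mu_pos
  have hmu0 := h.muhat_pos hμ
  have hdead : S.gap ≤ 0 → f S.y ≤ f S.y - (1 + β) * S.gap := fun h0 => by nlinarith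
  unfold State.awgTest
  split_ifs with h1 h2
  -- With a nonpositive gap estimate the level is not below `f ȳ`, and the iterates never leave `ȳ`.
  · have hgap : 0 < S.gap := by
      by_contra! h0
      rw [hc.norm_sub_eq_zero h.y_mem (hdead h0)] at h1
      exact absurd h1 (not_lt.2 (Real.sqrt_nonneg _))
    obtain ⟨h3, h4⟩ := h.awgSucceed hS hθ hθ1 hβ hε hD hp hgap fun z hz hfz => by
      refine le_trans ?_ (hc.sq_norm_le hz hfz)
      have := (Real.sqrt_lt' ((Real.sqrt_nonneg _).trans_lt h1)).1 h1
      rw [← mul_assoc]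
      exact this.le
    exact ⟨h3, Or.inr ⟨Nat.le_succ _, rfl, h4⟩⟩
  -- For `μ̂ ≤ μ` the gap estimate is valid, and no point can lie below `f ȳ - Δ̃`.
  · have hmu : μ < S.muhat := by
      by_contra! h0
      have h3 := h.gap_valid h0
      have h4 := hc.lt_of_awg_fails (by linarith) hβ (not_lt.1 h1) h2
      linarith [optVal_le hS.growth.1 hc.xhat_mem]
    obtain ⟨h3, h4⟩ := h.awgFail hS hθ hθ1 hβ hε hD hp hmu
    exact ⟨h3, Or.inr ⟨le_rfl, rfl, h4⟩⟩
  · refine ⟨⟨h.y_mem, h.flow_eq, h.muhat_ge, h.gap_valid, h.prev_valid, h.first, h.agr, ?_, ?_⟩,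
      Or.inl ⟨le_rfl, hct, rfl⟩⟩
    · simpa only [State.level, hp] using hc
    · have h3 := awg_time_le (θ := θ) hβ hS.L_pos hμ h.muhat_ge (hc.Lbar_le hS.L_pos)
        fun h0 => hc.Lbar_eq_zero h.y_mem (hdead h0)
      have h4 := not_le.1 (not_or.1 h2).2
      unfold State.radius at h4
      change (c.t : ℝ) + 1 ≤ _
      linarith

theorem progress_agrTest (h : S.Invariant X f g L μ θ β) (hS : Setting X f g m L μ)
    (hθ : 1 / 2 < θ) (hθ1 : θ < 1) (hβ : 0 < β) (hε : 0 < ε)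
    (hp : S.phase = .agr) {c : Sub n}
    (hc : c.Invariant X f S.y (f S.y - θ * S.gap) L) (hct : c.t = S.sub.t + 1) :
    Progress X f g L μ θ β ε 0 S (S.agrTest f g θ c) := by
  have hμ := hS.mu_pos
  have hθ0 : 0 < θ := by linarith
  have hmu0 := h.muhat_pos hμ
  obtain ⟨-, -, -, hgap, -⟩ := h.agr hp
  unfold State.agrTest
  split_ifs with h1 h2 h5
  · obtain ⟨h3, h4⟩ := h.agrLower hS hθ0 hθ1 hβ hε hp fun z hz hfz => by
      rw [← mul_assoc]
      exact h1.trans (hc.sq_norm_le hz hfz)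
    exact ⟨h3, Or.inr ⟨Nat.le_succ _, rfl, h4⟩⟩
  · obtain ⟨h3, h4⟩ := h.agrUpper hS hθ0 hθ1 hβ hε hp hc.xhat_mem hc.f_xhat_le h2
    exact ⟨h3, Or.inr ⟨Nat.le_succ _, rfl, h4⟩⟩
  -- This branch is void: when the time limit is met, the upper test has already succeeded.
  · refine absurd ?_ h2
    rw [h.flow_eq]
    exact hc.le_of_agr_test hgap hθ hmu0 (not_le.1 h1) (Nat.ceil_le.1 h5)
  · refine ⟨⟨h.y_mem, h.flow_eq, h.muhat_ge, h.gap_valid, h.prev_valid, h.first, h.agr, ?_, ?_⟩,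
      Or.inl ⟨le_rfl, hct, rfl⟩⟩
    · simpa only [State.level, hp] using hc
    · have h3 := agr_time_le (β := β) hθ hS.L_pos hμ h.muhat_ge (hc.Lbar_le hS.L_pos)
      have h4 := Nat.lt_ceil.1 (not_le.1 h5)
      change (c.t : ℝ) + 1 ≤ _
      linarith

theorem progress (h : S.Invariant X f g L μ θ β) (hS : Setting X f g m L μ)
    (hθ : 1 / 2 < θ) (hθ1 : θ < 1) (hβ : 0 < β) (hε : 0 < ε) (hD : ε ≤ f S.y - optVal X f)
    {S' : State n} (hstep : Step X f g m θ β S S') :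
    Progress X f g L μ θ β ε m S S' := by
  have hθ0 : 0 < θ := by linarith
  obtain ⟨res, hres, rfl⟩ := hstep
  obtain ⟨k, hkm, hpws⟩ := hS.pws
  obtain ⟨phase, sub, y, flow, muhat, gap, cert, prev, calls⟩ := S
  cases res with
  | feasible xnew x Lt d =>
    have hc := h.sub.advance hS.convex hS.oracle hpws hkm hS.one_le hres
    -- The `m` evaluations are booked before the tests, which then add none beyond the one of a
    -- quartering.
    have h' := h.withCalls (calls + m)
    cases phase with
    | awg => exact h'.progress_awgTest hS hθ0 hθ1 hβ hε hD rfl hc rfl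
    | agr => exact h'.progress_agrTest hS hθ hθ1 hβ hε rfl hc rfl
  | infeasible j =>
    have hlt : ∀ z ∈ X, State.level f θ β _ < f z := fun z hz =>
      h.sub.lt_of_infeasible hS.convex hS.oracle hres hz
    have h' := h.withCalls (calls + j)
    have hj : j ≤ m := by
      cases hres
      assumption
    have hcalls : calls + j ≤ calls + m + 1 := by omega
    cases phase with
    | awg =>
      have hgap : 0 < gap := by
        have : f y - (1 + β) * gap < f y := hlt _ h.y_mem
        by_contra! h0
        nlinarith
      obtain ⟨h3, h4⟩ := h'.awgSucceed hS hθ0 hθ1 hβ hε hD rfl hgap fun z hz hfz =>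
        absurd hfz (not_le.2 (hlt z hz))
      exact ⟨h3, Or.inr ⟨hcalls, rfl, h4⟩⟩
    | agr =>
      obtain ⟨h3, h4⟩ := h'.agrLower hS hθ0 hθ1 hβ hε rfl fun z hz hfz =>
        absurd hfz (not_le.2 (hlt z hz))
      exact ⟨h3, Or.inr ⟨hcalls, rfl, h4⟩⟩

end State.Invariant

theorem State.calls_requarter (a b : ℝ) : (S.requarter f a b).calls = S.calls + 1 := rfl

/-- Needs no invariant: the lower bound makes the call count unbounded along a run, the upper bound
covers the last transition. -/
theorem Step.calls_mem (hm : 1 ≤ m) {S' : State n} (hstep : Step X f g m θ β S S') :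
    S.calls + 1 ≤ S'.calls ∧ S'.calls ≤ S.calls + m + 1 := by
  obtain ⟨res, hres, rfl⟩ := hstep
  cases res with
  | feasible xnew x Lt d =>
    rcases hp : S.phase with _ | _
    · simp only [State.update, hp, State.awgTest]
      split_ifs <;>
        simp only [State.awgSucceed, State.awgFail, State.calls_requarter] <;> omega
    · simp only [State.update, hp, State.agrTest]
      split_ifs <;>
        simp only [State.agrLower, State.agrUpper, State.agrFail, State.calls_requarter] <;> omega
  | infeasible j =>
    have hj : 1 ≤ j ∧ j ≤ m := by
      cases hres
      exact ⟨by assumption, by assumption⟩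
    rcases hp : S.phase with _ | _ <;>
      simp only [State.update, hp, State.awgSucceed, State.agrLower] <;> omega

/-- A bound for the number of gradient evaluations still to come. -/
noncomputable def State.potential (m : ℕ) (L μ θ β ε : ℝ) (S : State n) : ℝ :=
  m * (timeBound θ β L μ - S.sub.t) + (m * timeBound θ β L μ + 1) * S.remaining μ θ β ε

/-- At the end of a call the released `m T + 1` refills the budget `m T` of the next call and pays
for a quartering; the last `m` evaluations come from `t + 1 ≤ T`. -/
theorem Progress.calls_add_potential_le {S' : State n}
    (hS : S.Invariant X f g L μ θ β) (h : Progress X f g L μ θ β ε m S S') :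
    (S'.calls : ℝ) + S'.potential m L μ θ β ε ≤ S.calls + S.potential m L μ θ β ε := by
  have hT : 1 ≤ timeBound θ β L μ := one_le_timeBound
  have hm : (0 : ℝ) ≤ m := Nat.cast_nonneg m
  unfold State.potential
  rcases h.2 with ⟨h1, h2, h3⟩ | ⟨h1, h2, h3⟩
  · have h1' : (S'.calls : ℝ) ≤ S.calls + m := by exact_mod_cast h1
    rw [h2, h3]
    push_cast
    linarith
  · have h1' : (S'.calls : ℝ) ≤ S.calls + m + 1 := by exact_mod_cast h1
    rw [h2]
    have h4 := mul_le_mul_of_nonneg_left h3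
      (by positivity : 0 ≤ (m : ℝ) * timeBound θ β L μ + 1)
    have h5 := mul_le_mul_of_nonneg_left hS.time hm
    push_cast
    linarith

theorem State.Invariant.potential_nonneg (h : S.Invariant X f g L μ θ β)
    (hS : Setting X f g m L μ) (hθ : 0 < θ) (hθ1 : θ < 1) (hβ : 0 < β) (hε : 0 < ε)
    (hD : ε ≤ f S.y - optVal X f) : 0 ≤ S.potential m L μ θ β ε := by
  have hT : 1 ≤ timeBound θ β L μ := one_le_timeBound
  have h1 := h.remaining_nonneg hS hθ hθ1 hβ hε hD
  have h2 : 0 ≤ timeBound θ β L μ - S.sub.t := by linarith [h.time]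
  unfold State.potential
  positivity

theorem invariant_init (hS : Setting X f g m L μ) {y0 : E n} (hy : y0 ∈ X)
    {muhat1 : ℝ} (hmu : μ ≤ muhat1) : (init f g y0 muhat1).Invariant X f g L μ θ β := by
  have hμ := hS.mu_pos
  have hmu0 : 0 < muhat1 := hμ.trans_le hmu
  refine ⟨hy, rfl, ?_, ?_, ?_, ?_, ?_, Sub.Invariant.start hy, ?_⟩
  · change μ / 4 ≤ muhat1
    linarith
  · intro h1
    obtain rfl : muhat1 = μ := le_antisymm h1 hmu
    change f y0 - optVal X f ≤ 2 * ‖g y0‖ ^ 2 / muhat1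
    rw [le_div_iff₀ hμ]
    linarith [hS.growth.mul_gap_le hμ hS.closed hS.oracle hy]
  · exact fun q h1 => nomatch h1
  · intro _ _
    exact mul_div_cancel₀ _ hmu0.ne'
  · exact fun h1 => nomatch h1
  · simpa [init, Sub.start] using one_le_timeBound

/-- The number of gradient evaluations until accuracy `ε` is reached. -/
theorem exists_calls_le (hS : Setting X f g m L μ) (hθ : 1 / 2 < θ) (hθ1 : θ < 1)
    (hβ : 0 < β) (hε : 0 < ε) {run : ℕ → State n}
    (h0 : (run 0).Invariant X f g L μ θ β)
    (hrun : ∀ j, Step X f g m θ β (run j) (run (j + 1))) :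
    ∃ j, f (run j).y - optVal X f ≤ ε ∧ (j ≠ 0 → ε < f (run 0).y - optVal X f ∧
      ((run j).calls : ℝ) ≤ (run 0).calls + (run 0).potential m L μ θ β ε + m + 1) := by
  have hθ0 : 0 < θ := by linarith
  have key : ∀ j, (∀ i ≤ j, ε < f (run i).y - optVal X f) →
      (run j).Invariant X f g L μ θ β ∧ (run j).calls + (run j).potential m L μ θ β ε ≤
        (run 0).calls + (run 0).potential m L μ θ β ε := by
    intro j
    induction j with
    | zero => exact fun _ => ⟨h0, le_rfl⟩
    | succ j ih =>
      intro h
      obtain ⟨h1, h2⟩ := ih fun i hi => h i (by omega)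
      have h3 := h1.progress hS hθ hθ1 hβ hε (h j (by omega)).le (hrun j)
      exact ⟨h3.1, (h3.calls_add_potential_le h1).trans h2⟩
  have key' : ∀ j, (∀ i ≤ j, ε < f (run i).y - optVal X f) →
      ((run j).calls : ℝ) ≤ (run 0).calls + (run 0).potential m L μ θ β ε := by
    intro j h
    obtain ⟨h1, h2⟩ := key j h
    linarith [h1.potential_nonneg hS hθ0 hθ1 hβ hε (h j le_rfl).le]
  have hlow : ∀ j, j ≤ (run j).calls := by
    intro j
    induction j with
    | zero => exact Nat.zero_le _
    | succ j ih => exact (Nat.succ_le_succ ih).trans ((hrun j).calls_mem hS.one_le).1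
  have hex : ∃ j, f (run j).y - optVal X f ≤ ε := by
    by_contra! h
    obtain ⟨j, hj⟩ := exists_nat_gt ((run 0).calls + (run 0).potential m L μ θ β ε)
    have h1 := key' j fun i _ => h i
    have h2 : (j : ℝ) ≤ (run j).calls := by exact_mod_cast hlow j
    linarith
  classical
  refine ⟨Nat.find hex, Nat.find_spec hex, fun hne => ?_⟩
  have hmin : ∀ i < Nat.find hex, ε < f (run i).y - optVal X f := fun i hi =>
    not_le.1 (Nat.find_min hex hi)
  obtain ⟨j, hj⟩ := Nat.exists_eq_succ_of_ne_zero hne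
  rw [hj] at hmin ⊢
  refine ⟨hmin 0 (Nat.succ_pos j), ?_⟩
  -- The invariant is available only while the gap exceeds `ε`, so the potential is used one
  -- transition earlier; the final one costs at most `m + 1`.
  have h1 := key' j fun i hi => hmin i (by omega)
  have h2 : ((run (j + 1)).calls : ℝ) ≤ (run j).calls + m + 1 := by
    exact_mod_cast ((hrun j).calls_mem hS.one_le).2
  linarith

/-! ### The initial potential and the final bound -/

/-- The factor in front of the logarithms in the bound for the number of subroutine calls. -/
noncomputable def rateConst (θ β : ℝ) : ℝ :=
  2 * Real.log (8 * (1 + β) / θ) / -Real.log θ + 2 / -Real.log θ + 2 +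
    2 * Real.log (9 * (1 + β) / (4 * θ)) / -Real.log θ

theorem one_le_log_init {muhat1 : ℝ} (hμ : 0 < μ) (hmu : μ ≤ muhat1) :
    1 ≤ Real.logb 4 (4 * muhat1 / μ) := by
  rw [Real.le_logb_iff_rpow_le (by norm_num) (by have := hμ.trans_le hmu; positivity),
    Real.rpow_one, le_div_iff₀ hμ]
  linarith

theorem rateConst_nonneg (hθ : 0 < θ) (hθ1 : θ < 1) (hβ : 0 < β) : 0 ≤ rateConst θ β := by
  have hlog : 0 < -Real.log θ := neg_pos.2 (Real.log_neg hθ hθ1)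
  have h1 : 0 ≤ Real.log (9 * (1 + β) / (4 * θ)) :=
    Real.log_nonneg (State.Invariant.one_le_rate hθ hθ1 hβ)
  have h2 : 0 ≤ Real.log (8 * (1 + β) / θ) :=
    Real.log_nonneg (by rw [le_div_iff₀ hθ]; linarith)
  unfold rateConst
  positivity

theorem remaining_init_le (hθ : 0 < θ) (hθ1 : θ < 1) (hβ : 0 < β) (hε : 0 < ε) (hμ : 0 < μ)
    {y0 : E n} {muhat1 : ℝ} (hmu : μ ≤ muhat1) (hg : 0 < ‖g y0‖) :
    (init f g y0 muhat1).remaining μ θ β ε ≤ rateConst θ β *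
      (Real.logb 4 (4 * muhat1 / μ) + max 0 (Real.log (‖g y0‖ ^ 2 / (μ * ε)))) := by
  have hmu0 : 0 < muhat1 := hμ.trans_le hmu
  have hlog : 0 < -Real.log θ := neg_pos.2 (Real.log_neg hθ hθ1)
  have h1 : 0 ≤ Real.log (9 * (1 + β) / (4 * θ)) :=
    Real.log_nonneg (State.Invariant.one_le_rate hθ hθ1 hβ)
  have h2 : 0 ≤ Real.log (8 * (1 + β) / θ) :=
    Real.log_nonneg (by rw [le_div_iff₀ hθ]; linarith)
  have h3 := one_le_log_init hμ hmu
  -- The initial product `2 ‖g y0‖²` is free of `muhat1`, which thus enters only through the base-4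
  -- logarithm.
  have e : (init f g y0 muhat1).product θ β / minProduct μ θ β ε =
      8 * (1 + β) / θ * (‖g y0‖ ^ 2 / (μ * ε)) := by
    rw [State.product_none rfl, minProduct]
    simp only [init]
    field_simp
    norm_num
  simp only [State.remaining, e, rateConst]
  rw [Real.log_mul (by positivity) (by positivity)]
  change _ + _ * Real.logb 4 (4 * muhat1 / μ) + 1 ≤ _
  set q := Real.logb 4 (4 * muhat1 / μ)
  set w := max 0 (Real.log (‖g y0‖ ^ 2 / (μ * ε))) with hw
  have hw0 : 0 ≤ w := le_max_left _ _
  have hw1 : Real.log (‖g y0‖ ^ 2 / (μ * ε)) ≤ w := le_max_right _ _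
  set A := Real.log (8 * (1 + β) / θ)
  set c := Real.log (9 * (1 + β) / (4 * θ))
  set l := -Real.log θ
  have hA : 0 ≤ 2 * A / l := by positivity
  have hc : 0 ≤ 2 * c / l := by positivity
  have hl : 0 ≤ 2 / l := by positivity
  calc 2 * (A + Real.log (‖g y0‖ ^ 2 / (μ * ε))) / l + (1 + 2 * c / l) * q + 1
      ≤ 2 * (A + w) / l + (1 + 2 * c / l) * q + 1 := by gcongr
    _ = 2 * A / l * 1 + 2 / l * w + q + 2 * c / l * q + 1 := by ring
    _ ≤ 2 * A / l * (q + w) + 2 / l * (q + w) + q + 2 * c / l * (q + w) + (q + w) := by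
      gcongr <;> linarith
    _ ≤ _ := by linarith

end Run

end RApex

theorem mainTheorem3 (θ β : ℝ) (hθ : 1 / 2 < θ) (hθ1 : θ < 1) (hβ : 0 < β) :
    ∃ C : ℝ, 0 < C ∧
      ∀ (n : ℕ) (X : Set (RApex.E n)) (f : RApex.E n → ℝ) (g : RApex.E n → RApex.E n)
        (k m : ℕ) (L μstar muhat1 : ℝ) (y0 : RApex.E n),
        Convex ℝ X → IsClosed X → ConvexOn ℝ X f →
        RApex.IsSubgradientOracle X f g →
        0 < μstar → RApex.HasQuadraticGrowthModulus X f μstar →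
        RApex.IsPiecewiseSmooth X f g k L →
        k ≤ m → μstar ≤ muhat1 → y0 ∈ X →
        -- the algorithm never gets stuck
        (∀ S, Relation.ReflTransGen (RApex.Step X f g m θ β) (RApex.init f g y0 muhat1) S →
          ∃ S', RApex.Step X f g m θ β S S') ∧
        -- every run reaches accuracy `ε` within the stated number of gradient evaluations
        (∀ run : ℕ → RApex.State n,
          run 0 = RApex.init f g y0 muhat1 →
          (∀ j, RApex.Step X f g m θ β (run j) (run (j + 1))) →
          ∀ ε : ℝ, 0 < ε →
            ∃ j, f (run j).y - RApex.optVal X f ≤ ε ∧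
              ((run j).calls : ℝ) ≤ C * m * max 1 (Real.sqrt (L / μstar)) *
                (Real.logb 4 (4 * muhat1 / μstar) +
                  max 0 (Real.log (‖g y0‖ ^ 2 / (μstar * ε))))) := by
  have hθ0 : 0 < θ := by linarith
  have hB : 0 ≤ RApex.rateConst θ β := RApex.rateConst_nonneg hθ0 hθ1 hβ
  set κ := Real.sqrt (70 * (1 + β) / β) + Real.sqrt (70 * θ / (2 * θ - 1)) with hκ
  have hκ0 : 0 ≤ κ := by positivity
  refine ⟨(κ + 1) * (4 + 2 * RApex.rateConst θ β), by positivity, ?_⟩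
  intro n X f g k m L μ muhat1 y0 hX hXc hf hg hμ hgrowth hpws hkm hmu hy
  -- The point `y0` lies in some piece, so there is at least one.
  have hm : 1 ≤ m := by
    obtain ⟨-, P, hP, -⟩ := hpws
    rw [← hP] at hy
    obtain ⟨i, -⟩ := Set.mem_iUnion.1 hy
    have := i.pos
    omega
  have hS : RApex.Setting X f g m L μ := ⟨hX, hXc, hf, hg, hμ, hgrowth, ⟨k, hkm, hpws⟩, hm⟩
  refine ⟨fun S _ => ?_, fun run h0 hrun ε hε => ?_⟩
  · obtain ⟨res, hres⟩ := RApex.exists_oneStep (f := f) (g := g) (y := S.y)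
      (lvl := S.level f θ β) (a := RApex.alpha (S.sub.t + 1)) (xhat := S.sub.xhat) hXc hm S.sub.x
    exact ⟨_, res, hres, rfl⟩
  have hinv : (run 0).Invariant X f g L μ θ β := h0 ▸ RApex.invariant_init hS hy hmu
  obtain ⟨j, hj, hcalls⟩ := RApex.exists_calls_le hS hθ hθ1 hβ hε hinv hrun
  refine ⟨j, hj, ?_⟩
  have hq := RApex.one_le_log_init hμ hmu
  have hw : 0 ≤ max 0 (Real.log (‖g y0‖ ^ 2 / (μ * ε))) := le_max_left _ _
  have hM : 1 ≤ max 1 (Real.sqrt (L / μ)) := le_max_left _ _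
  have hm' : (1 : ℝ) ≤ m := by exact_mod_cast hm
  have hmM : 1 ≤ m * max 1 (Real.sqrt (L / μ)) := one_le_mul_of_one_le_of_one_le hm' hM
  have hT : RApex.timeBound θ β L μ ≤ (κ + 1) * max 1 (Real.sqrt (L / μ)) := by
    rw [RApex.timeBound, ← hκ]
    linarith
  have hT1 : 1 ≤ RApex.timeBound θ β L μ := RApex.one_le_timeBound
  have hrem := fun hgy => RApex.remaining_init_le (f := f) (g := g) hθ0 hθ1 hβ hε hμ hmu
    (y0 := y0) hgy
  set Z := Real.logb 4 (4 * muhat1 / μ) + max 0 (Real.log (‖g y0‖ ^ 2 / (μ * ε)))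
  set M := max 1 (Real.sqrt (L / μ))
  set B := RApex.rateConst θ β
  set T := RApex.timeBound θ β L μ
  have hZ : 1 ≤ Z := by linarith
  -- Even an accurate start has cost one evaluation; the base-4 logarithm, being at least `1`,
  -- covers it.
  rcases eq_or_ne j 0 with rfl | hne
  · rw [h0]
    have h1 : 1 ≤ (κ + 1) * (4 + 2 * B) := by nlinarith [mul_nonneg hκ0 hB]
    have h2 := one_le_mul_of_one_le_of_one_le (one_le_mul_of_one_le_of_one_le h1 hmM) hZ
    simpa [RApex.init, mul_assoc] using h2
  · obtain ⟨hD, hle⟩ := hcalls hne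
    rw [h0] at hD hle
    -- A zero subgradient would make `y0` optimal; this excludes the logarithm of zero.
    have hgy : 0 < ‖g y0‖ := by
      have h1 := hgrowth.mul_gap_le hμ hXc hg hy
      have h2 : 0 < μ * (f y0 - RApex.optVal X f) := mul_pos hμ (hε.trans hD)
      have h3 : 0 < ‖g y0‖ ^ 2 := by linarith
      exact (norm_nonneg _).lt_of_ne' fun h => by simp [h] at h3
    have hR := hrem hgy
    have hR0 : 0 ≤ B * Z := by positivity
    refine hle.trans ?_
    have hpot : (RApex.init f g y0 muhat1).potential m L μ θ β ε ≤
        m * T + (m * T + 1) * (B * Z) := by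
      unfold RApex.State.potential
      have h1 := mul_le_mul_of_nonneg_left hR (by positivity : 0 ≤ (m : ℝ) * T + 1)
      have h2 : ((RApex.init f g y0 muhat1).sub.t : ℝ) = 0 := Nat.cast_zero
      rw [h2, sub_zero]
      linarith
    have hc1 : ((RApex.init f g y0 muhat1).calls : ℝ) = 1 := Nat.cast_one
    rw [hc1]
    have hmT : (m : ℝ) ≤ m * T := le_mul_of_one_le_right (by positivity) hT1
    calc _ ≤ 1 + (m * T + (m * T + 1) * (B * Z)) + m + 1 := by linarith
      _ ≤ m * T * 4 + m * T * 2 * (B * Z) := by nlinarith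
      _ ≤ m * T * (4 * Z) + m * T * 2 * (B * Z) := by gcongr; linarith
      _ = (4 + 2 * B) * m * Z * T := by ring
      _ ≤ (4 + 2 * B) * m * Z * ((κ + 1) * M) := by gcongr
      _ = _ := by ring
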